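/- Let $n\ge 1$. An instance of dimension $n$ is an element of $\{0,1\}^n$ and a partial instance of dimension $n$ is an element of $\{0,1,\bot\}^n$; a partial instance $\mathbf e_1$ is subsumed by $\mathbf e_2$ if $\mathbf e_1[i]=\mathbf e_2[i]$ for every $i$ with $\mathbf e_1[i]\neq\bot$. FOIL is first-order logic with equality over a unary predicate $\mathrm{Pos}$ and a binary predicate $\subseteq$, with formulas built from atoms by $\neg,\vee,\wedge,\exists,\forall$. A formula is evaluated over a Boolean function (model) $\mathcal M:\{0,1\}^n\to\{0,1\}$ in the structure whose domain is $\{0,1,\bot\}^n$, where $\mathrm{Pos}$ holds exactly for the instances $\mathbf e\in\{0,1\}^n$ with $\mathcal M(\mathbf e)=1$, and $\subseteq$ is subsumption. The fragment $\exists$FOIL consists of the formulas in which no universal quantifier occurs and no existential quantifier appears under a negation; $\forall$FOIL is defined by exchanging the roles of the two quantifiers. A binary decision diagram (BDD) of dimension $n$ is a finite rooted directed acyclic graph in which each leaf is labeled true or false, and each internal node is labeled with a feature in $\{1,\dots,n\}$ and has two outgoing edges, labeled $0$ and $1$. It represents the Boolean function that maps $\mathbf e\in\{0,1\}^n$ to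 $1$ if and only if the path from the root that leaves each node with label $j$ by the edge with label $\mathbf e[j]$ ends in a leaf labeled true. A BDD is free (FBDD) if no two nodes on a path from the root to a leaf have the same feature as label; it is ordered (OBDD) if, for some linear order on $\{1,\dots,n\}$, the features strictly increase along every path from the root to a leaf; a decision tree (DT) is an FBDD whose underlying graph is a tree. For a formula $\varphi(x_1,\dots,x_k)$ and a class $\mathcal C$ of BDDs, $\mathrm{Eval}(\varphi,\mathcal C)$ is the problem of deciding, given a BDD $\mathcal M\in\mathcal C$ of some dimension $n\ge1$ and partial instances $\mathbf e_1,\dots,\mathbf e_k$ of dimension $n$, whether $\mathcal M$ satisfies $\varphi(\mathbf e_1,\dots,\mathbf e_k)$. **Proposition.** For every fixed formula $\varphi$ in $\exists$FOIL or in $\forall$FOIL, the problems $\mathrm{Eval}(\varphi,\mathrm{DT})$, $\mathrm{Eval}(\varphi,\mathrm{OBDD})$ and $\mathrm{Eval}(\varphi,\mathrm{FBDD})$ can be solved in polynomial time. -/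

import Mathlib

namespace FOIL

/-! ### Instances, partial instances and Boolean models -/

/-- Instances of dimension `n`: elements of `{0,1}^n`. -/
abbrev Instance (n : ℕ) : Type := Fin n → Bool

/-- Partial instances of dimension `n`: elements of `{0,1,⊥}^n`, with `none` for `⊥`. -/
abbrev PartialInstance (n : ℕ) : Type := Fin n → Option Bool

/-- `e₁` is subsumed by `e₂`: they agree wherever `e₁` is defined. -/
def Subsumed {n : ℕ} (e₁ e₂ : PartialInstance n) : Prop :=
  ∀ i, e₁ i ≠ none → e₁ i = e₂ i

/-- The interpretation of `Pos`: the (full) instances that the model classifies as `1`. -/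
def IsPos {n : ℕ} (M : Instance n → Bool) (e : PartialInstance n) : Prop :=
  ∃ x : Instance n, (∀ i, e i = some (x i)) ∧ M x = true

/-! ### Formulas -/

/-- First-order formulas over the vocabulary `{Pos, ⊆}` with equality, whose free variables are
among `x_0, …, x_{k-1}`. A quantifier in a formula with `k` free variables binds `x_k`. -/
inductive Formula : ℕ → Type
  | eq {k : ℕ} (x y : Fin k) : Formula k
  | pos {k : ℕ} (x : Fin k) : Formula k
  | sub {k : ℕ} (x y : Fin k) : Formula k
  | not {k : ℕ} (φ : Formula k) : Formula k
  | or {k : ℕ} (φ ψ : Formula k) : Formula k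
  | and {k : ℕ} (φ ψ : Formula k) : Formula k
  | ex {k : ℕ} (φ : Formula (k + 1)) : Formula k
  | all {k : ℕ} (φ : Formula (k + 1)) : Formula k

namespace Formula

/-- Satisfaction of a formula in the structure of a model `M` of dimension `n`. The domain of this
structure is the set of all partial instances of dimension `n`. -/
def Sat {n : ℕ} (M : Instance n → Bool) : {k : ℕ} → Formula k → (Fin k → PartialInstance n) → Prop
  | _, eq x y, ν => ν x = ν y
  | _, pos x, ν => IsPos M (ν x)
  | _, sub x y, ν => Subsumed (ν x) (ν y)
  | _, not φ, ν => ¬ Sat M φ ν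
  | _, or φ ψ, ν => Sat M φ ν ∨ Sat M ψ ν
  | _, and φ ψ, ν => Sat M φ ν ∧ Sat M ψ ν
  | _, @ex k φ, ν => ∃ a : PartialInstance n,
      Sat M φ (Fin.snoc (α := fun _ : Fin (k + 1) => PartialInstance n) ν a)
  | _, @all k φ, ν => ∀ a : PartialInstance n,
      Sat M φ (Fin.snoc (α := fun _ : Fin (k + 1) => PartialInstance n) ν a)

/-- No quantifier occurs in the formula. -/
def QuantifierFree : {k : ℕ} → Formula k → Prop
  | _, eq _ _ => True
  | _, pos _ => True
  | _, sub _ _ => True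
  | _, not φ => φ.QuantifierFree
  | _, or φ ψ => φ.QuantifierFree ∧ ψ.QuantifierFree
  | _, and φ ψ => φ.QuantifierFree ∧ ψ.QuantifierFree
  | _, ex _ => False
  | _, all _ => False

/-- The existential fragment: no universal quantifier occurs, and no existential quantifier
appears under a negation. -/
def IsExistential : {k : ℕ} → Formula k → Prop
  | _, eq _ _ => True
  | _, pos _ => True
  | _, sub _ _ => True
  | _, not φ => φ.QuantifierFree
  | _, or φ ψ => φ.IsExistential ∧ ψ.IsExistential
  | _, and φ ψ => φ.IsExistential ∧ ψ.IsExistential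
  | _, ex φ => φ.IsExistential
  | _, all _ => False

/-- The universal fragment: no existential quantifier occurs, and no universal quantifier
appears under a negation. -/
def IsUniversal : {k : ℕ} → Formula k → Prop
  | _, eq _ _ => True
  | _, pos _ => True
  | _, sub _ _ => True
  | _, not φ => φ.QuantifierFree
  | _, or φ ψ => φ.IsUniversal ∧ ψ.IsUniversal
  | _, and φ ψ => φ.IsUniversal ∧ ψ.IsUniversal
  | _, ex _ => False
  | _, all φ => φ.IsUniversal

end Formula

/-! ### Binary decision diagrams -/

/-- A node of a diagram with node set `V`: a leaf labelled `true` or `false`, or an internal node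
labelled by a feature, together with the targets of its outgoing edges labelled `0` and `1`. -/
inductive Node (n : ℕ) (V : Type) : Type
  | leaf (b : Bool) : Node n V
  | branch (i : Fin n) (next : Bool → V) : Node n V

/-- There is an edge labelled `b` from `u` to `v`. -/
def LabelledEdge {n : ℕ} {V : Type} (node : V → Node n V) (u : V) (b : Bool) (v : V) : Prop :=
  ∃ i next, node u = Node.branch i next ∧ next b = v

/-- There is an edge from `u` to `v`. -/
def Edge {n : ℕ} {V : Type} (node : V → Node n V) (u v : V) : Prop :=
  ∃ b, LabelledEdge node u b v

/-- Binary decision diagrams over instances of dimension `n`: finite rooted acyclic graphs with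
labels on nodes and edges. The nodes come in an arbitrary order. -/
structure BDD (n : ℕ) where
  /-- the number of nodes -/
  size : ℕ
  /-- the label and the outgoing edges of each node -/
  node : Fin size → Node n (Fin size)
  /-- the root -/
  root : Fin size
  /-- there is no directed cycle -/
  acyclic : ∀ v, ¬ Relation.TransGen (Edge node) v v
  /-- every node can be reached from the root -/
  rooted : ∀ v, Relation.ReflTransGen (Edge node) root v

namespace BDD

variable {n : ℕ}

/-- The move from `u` along the edge that the instance `x` selects. -/
def Step (M : BDD n) (x : Instance n) (u v : Fin M.size) : Prop :=
  ∃ i next, M.node u = Node.branch i next ∧ next (x i) = v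

open Classical in
/-- The Boolean function of a diagram: `x` is positive iff the path of `x` from the root ends in
a leaf labelled `true`. -/
noncomputable def eval (M : BDD n) (x : Instance n) : Bool :=
  decide (∃ v, Relation.ReflTransGen (M.Step x) M.root v ∧ M.node v = Node.leaf true)

/-- Node `u` is internal and labelled with feature `i`. -/
def HasFeature (M : BDD n) (u : Fin M.size) (i : Fin n) : Prop :=
  ∃ next, M.node u = Node.branch i next

/-- Node `u` appears before node `v` on some path. Since all nodes can be reached from the root
and all maximal paths end in a leaf, this path may be taken from the root to a leaf. -/
def Before (M : BDD n) (u v : Fin M.size) : Prop :=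
  Relation.TransGen (Edge M.node) u v

/-- Free diagrams: no feature labels two nodes of the same path. -/
def IsFree (M : BDD n) : Prop :=
  ∀ u v i, M.Before u v → M.HasFeature u i → ¬ M.HasFeature v i

/-- Ordered diagrams: for some linear order on the features, labels increase along paths. -/
def IsOrdered (M : BDD n) : Prop :=
  ∃ r : LinearOrder (Fin n), ∀ u v i j,
    M.Before u v → M.HasFeature u i → M.HasFeature v j → r.lt i j

/-- The underlying graph is a tree: no node is the target of two edges (by acyclicity the root is
then the target of none). -/
def IsTree (M : BDD n) : Prop :=
  ∀ u b u' b' v, LabelledEdge M.node u b v → LabelledEdge M.node u' b' v → u = u' ∧ b = b'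

end BDD

/-- Classes of diagrams, of all dimensions. -/
abbrev BDDClass : Type := ∀ n : ℕ, BDD n → Prop

/-- The class of free binary decision diagrams. -/
def FBDD : BDDClass := fun _ M => M.IsFree

/-- The class of ordered binary decision diagrams. -/
def OBDD : BDDClass := fun _ M => M.IsOrdered

/-- The class of decision trees: free diagrams whose underlying graph is a tree. -/
def DT : BDDClass := fun _ M => M.IsFree ∧ M.IsTree

/-! ### The evaluation problem -/

/-- Inputs of the evaluation problem of a formula with `k` free variables over the class `C`. -/
structure EvalInput (C : BDDClass) (k : ℕ) where
  /-- the dimension -/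
  dim : ℕ
  /-- dimensions are positive -/
  dim_pos : 0 < dim
  /-- the model -/
  model : BDD dim
  /-- the model belongs to the class -/
  mem : C dim model
  /-- the partial instances that interpret the free variables -/
  inst : Fin k → PartialInstance dim

/-- The alphabet in which inputs are written. -/
inductive Symbol : Type
  | val (v : Option Bool)
  | tick
  | sep
  | leaf (b : Bool)
  | branch

/-- Numbers are written in unary and followed by a separator. The dimension counts in full in the
size of an input, and all other numbers are below the dimension or below the number of nodes, so
writing those in binary would change the length of an input only polynomially. -/
def encodeNum (m : ℕ) : List Symbol :=
  List.replicate m Symbol.tick ++ [Symbol.sep]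

/-- The code of a node: its label, and for an internal node the targets of its two edges. -/
def encodeNode {n s : ℕ} : Node n (Fin s) → List Symbol
  | Node.leaf b => [Symbol.leaf b]
  | Node.branch i next =>
      Symbol.branch :: (encodeNum i ++ encodeNum (next false) ++ encodeNum (next true))

/-- The code of a partial instance: its components, followed by a separator. -/
def encodeInstance {n : ℕ} (e : PartialInstance n) : List Symbol :=
  (List.finRange n).map (fun i => Symbol.val (e i)) ++ [Symbol.sep]

/-- The code of an input: the dimension, the root, the list of nodes, the partial instances. -/
def encodeInput {C : BDDClass} {k : ℕ} (a : EvalInput C k) : List Symbol :=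
  encodeNum a.dim ++ encodeNum a.model.root
    ++ (List.finRange a.model.size).flatMap (fun v => encodeNode (a.model.node v)) ++ [Symbol.sep]
    ++ (List.finRange k).flatMap (fun j => encodeInstance (a.inst j))

open Classical in
/-- The answer to an input: whether the model satisfies the formula at the partial instances. -/
noncomputable def evalAnswer {k : ℕ} (φ : Formula k) (C : BDDClass) (a : EvalInput C k) : Bool :=
  decide (φ.Sat a.model.eval a.inst)

/-- For the fixed formula `φ`, the evaluation problem over the class `C` can be solved in
polynomial time: some multi-stack Turing machine computes the answer to each input in a number of
steps that is bounded by a polynomial in the length of the code of the input. -/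
def EvalInPolyTime {k : ℕ} (φ : Formula k) (C : BDDClass) : Prop :=
  Nonempty (Turing.TM2ComputableInPolyTime (encodeInput (C := C) (k := k))
    Computability.encodeBool (evalAnswer φ C))

end FOIL

/-!
Only free diagrams matter: decision trees are free by definition, and in an ordered diagram a
feature cannot occur twice on a path because the order is irreflexive. Universal formulas are
negations of existential ones up to logical equivalence, so it suffices to evaluate formulas that
ask for partial instances which, together with the given ones, have an atomic type from a fixed
finite list (`IsExistentialPred.sat`, `IsExistentialPred.not_sat`).

The mathematical core is a certificate of constant size for the existence of these partial
instances. Write an assignment as a table with a row for each variable and a column for each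
feature. Which variables subsume which is determined by the set `H` of columns that occur, and there
are only boundedly many such sets. One feature `g h` for each column `h` in `H` suffices to witness
that `h` occurs. What remains is to choose the columns at the other features so that the rows of the
positive variables are positive instances and the rows of the other variables without undefined
values are not. A diagram is free, so a path from the root that respects the columns allowed at each
feature is the path of some instance (`BDD.exists_eval_of_reaches`); hence for one such row it is
enough to find a path to a leaf with the right label. Different rows can be treated separately,
because the rows that result can always be completed to a table: at a feature that is not in the
range of `g`, no column needs to occur, and therefore non-subsumption is not at stake; subsumption
is preserved if rows that are to be equal get the same instance, and if all rows with an undefined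
value somewhere are as undefined as possible at this feature (`IsWitness.exists_assignment`).
Conversely, an assignment yields such a certificate (`exists_witness`).

It remains to check, in polynomial time on a multi-stack Turing machine, whether there are features
`g h` that satisfy these conditions. For this purpose there is a small logic about strings
(`Expr`) with quantifiers over numbers below the length of the string, and with the iteration of
a definable operator on sets of numbers for a given number of rounds. Its formulas are compiled to
structured stack programs (`Expr.compile`), and these to Turing machines (`Prog.code`); loops run
over numbers below the length of the string, so that the time is polynomial for each fixed formula
(`Expr.compile_runsIn`, `Expr.computable`). Addition and counting are definable by iteration, which
suffices to read the code of an input, and so is reachability in a diagram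
(`BDD.reaches_iff_rounds`). Together this shows that existential predicates are definable over
the codes of inputs (`Definable.existentialPred`).
-/

namespace FOIL

open Function

/-! ### Structured stack programs and their compilation to Turing machines -/

/-- Registers of a stack program: a flag and the symbol that was read last. -/
abbrev Regs : Type := Bool × Option Symbol

/-- Contents of the stacks of a stack program. -/
abbrev Stacks (K : Type) : Type := K → List Symbol

/-- Structured programs over stacks of symbols that are indexed by `K`. -/
inductive Prog (K : Type) : Type
  | push (s : K) (f : Regs → Symbol)
  | pop (s : K) (f : Regs → Option Symbol → Regs)
  | peek (s : K) (f : Regs → Option Symbol → Regs)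
  | seq (p q : Prog K)
  | ite (c : Regs → Bool) (p q : Prog K)
  | loop (c : Regs → Bool) (p : Prog K)

namespace Prog

variable {K : Type}

/-- The control points of a program. -/
def Label : Prog K → Type
  | push _ _ => Unit
  | pop _ _ => Unit
  | peek _ _ => Unit
  | seq p q => p.Label ⊕ q.Label
  | ite _ p q => Option (p.Label ⊕ q.Label)
  | loop _ p => Option p.Label

/-- The control point at which a program starts. -/
def entry : (p : Prog K) → p.Label
  | push _ _ => ()
  | pop _ _ => ()
  | peek _ _ => ()
  | seq p _ => Sum.inl p.entry
  | ite _ _ _ => none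
  | loop _ _ => none

theorem finite_label (p : Prog K) : Finite p.Label := by
  induction p with
  | push => exact inferInstanceAs (Finite Unit)
  | pop => exact inferInstanceAs (Finite Unit)
  | peek => exact inferInstanceAs (Finite Unit)
  | seq p q hp hq => exact inferInstanceAs (Finite (p.Label ⊕ q.Label))
  | ite c p q hp hq => exact inferInstanceAs (Finite (Option (p.Label ⊕ q.Label)))
  | loop c p hp => exact inferInstanceAs (Finite (Option p.Label))

/-- Alphabets of the compiled machine: besides the stacks of the program, which hold symbols, there
is an output stack `none`, which holds Booleans. -/
abbrev Alphabet (K : Type) : Option K → Type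
  | none => Bool
  | some _ => Symbol

/-- The code at each control point of a program. Here `emb` embeds the control points into those
of the whole machine, and `exit` is the control point at which the machine goes on. -/
def code {Λ : Type} : (p : Prog K) → (emb : p.Label → Λ) → (exit : Λ) → p.Label →
    Turing.TM2.Stmt (Alphabet K) Λ Regs
  | push s f, _, exit, _ => .push (some s) f (.goto fun _ => exit)
  | pop s f, _, exit, _ => .pop (some s) f (.goto fun _ => exit)
  | peek s f, _, exit, _ => .peek (some s) f (.goto fun _ => exit)
  | seq p q, emb, _, Sum.inl l => p.code (emb ∘ Sum.inl) (emb (Sum.inr q.entry)) l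
  | seq _ q, emb, exit, Sum.inr l => q.code (emb ∘ Sum.inr) exit l
  | ite c p q, emb, _, none => .branch c (.goto fun _ => emb (some (Sum.inl p.entry)))
      (.goto fun _ => emb (some (Sum.inr q.entry)))
  | ite _ p _, emb, exit, some (Sum.inl l) => p.code (emb ∘ some ∘ Sum.inl) exit l
  | ite _ _ q, emb, exit, some (Sum.inr l) => q.code (emb ∘ some ∘ Sum.inr) exit l
  | loop c p, emb, exit, none => .branch c (.goto fun _ => emb (some p.entry))
      (.goto fun _ => exit)
  | loop _ p, emb, _, some l => p.code (emb ∘ some) (emb none) l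

variable [DecidableEq K]

/-- `p.Runs s s' t`: started in `s`, the program `p` ends in `s'` after exactly `t` steps. The
number of steps is that of the Turing machine to which `p` compiles. -/
inductive Runs : Prog K → Regs × Stacks K → Regs × Stacks K → ℕ → Prop
  | push (s f v S) : Runs (.push s f) (v, S) (v, update S s (f v :: S s)) 1
  | pop (s f v S) : Runs (.pop s f) (v, S) (f v (S s).head?, update S s (S s).tail) 1
  | peek (s f v S) : Runs (.peek s f) (v, S) (f v (S s).head?, S) 1
  | seq {p q a b c t₁ t₂} : Runs p a b t₁ → Runs q b c t₂ → Runs (.seq p q) a c (t₁ + t₂)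
  | ite_true {c p q a b t} : c a.1 = true → Runs p a b t → Runs (.ite c p q) a b (1 + t)
  | ite_false {c p q a b t} : c a.1 = false → Runs q a b t → Runs (.ite c p q) a b (1 + t)
  | loop_false {c p a} : c a.1 = false → Runs (.loop c p) a a 1
  | loop_true {c p a b d t₁ t₂} : c a.1 = true → Runs p a b t₁ → Runs (.loop c p) b d t₂ →
      Runs (.loop c p) a d (1 + t₁ + t₂)

/-- The stacks of the compiled machine while a program runs: the output stack is empty. -/
def withOutput (S : Stacks K) : ∀ s : Option K, List (Alphabet K s)
  | none => []
  | some s => S s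

theorem update_withOutput (S : Stacks K) (s : K) (l : List Symbol) :
    update (withOutput S) (some s) l = withOutput (update S s l) := by
  funext s'
  cases s' with
  | none => simp [withOutput]
  | some s' =>
    by_cases h : s' = s
    · subst h; simp [withOutput]
    · simp [withOutput, update_of_ne, h]

/-- The configuration of the compiled machine at control point `l` in program state `a`. -/
def cfg {Λ : Type} (l : Λ) (a : Regs × Stacks K) : Turing.TM2.Cfg (Alphabet K) Λ Regs :=
  ⟨some l, a.1, withOutput a.2⟩

/-- A machine that contains the code of a program simulates its runs step by step. -/
theorem Runs.simulate {Λ : Type} {p : Prog K} {a b : Regs × Stacks K} {t : ℕ} (h : p.Runs a b t)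
    (M : Λ → Turing.TM2.Stmt (Alphabet K) Λ Regs) (emb : p.Label → Λ) (exit : Λ)
    (hM : ∀ l, M (emb l) = p.code emb exit l) :
    (flip bind (Turing.TM2.step M))^[t] (some (cfg (emb p.entry) a)) = some (cfg exit b) := by
  induction h generalizing exit with
  | push s f v S =>
    simp [flip, cfg, hM, code, Turing.TM2.step, ← update_withOutput, withOutput]
  | pop s f v S =>
    simp [flip, cfg, hM, code, Turing.TM2.step, ← update_withOutput, withOutput]
  | peek s f v S =>
    simp [flip, cfg, hM, code, Turing.TM2.step, withOutput]
  | @seq p q a b c t₁ t₂ _ _ ih₁ ih₂ =>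
    rw [add_comm, iterate_add_apply]
    have h₁ := ih₁ (emb ∘ Sum.inl) (emb (Sum.inr q.entry)) (fun l => hM (Sum.inl l))
    have h₂ := ih₂ (emb ∘ Sum.inr) exit (fun l => hM (Sum.inr l))
    exact (congrArg _ h₁).trans h₂
  | @ite_true c p q a b t hc _ ih =>
    have h0 := hM none
    rw [add_comm, iterate_add_apply]
    refine Eq.trans (congrArg _ ?_) (ih (emb ∘ some ∘ Sum.inl) exit fun l => hM (some (Sum.inl l)))
    simp [flip, cfg, entry, h0, code, Turing.TM2.step, hc]
    rfl
  | @ite_false c p q a b t hc _ ih =>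
    have h0 := hM none
    rw [add_comm, iterate_add_apply]
    refine Eq.trans (congrArg _ ?_) (ih (emb ∘ some ∘ Sum.inr) exit fun l => hM (some (Sum.inr l)))
    simp [flip, cfg, entry, h0, code, Turing.TM2.step, hc]
    rfl
  | @loop_false c p a hc =>
    have h0 := hM none
    simp [flip, cfg, entry, h0, code, Turing.TM2.step, hc]
  | @loop_true c p a b d t₁ t₂ hc _ _ ih₁ ih₂ =>
    have h0 := hM none
    rw [add_comm, iterate_add_apply, add_comm 1, iterate_add_apply]
    refine Eq.trans (congrArg _ (Eq.trans (congrArg _ ?_)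
      (ih₁ (emb ∘ some) (emb none) fun l => hM (some l)))) (ih₂ emb exit hM)
    simp [flip, cfg, entry, h0, code, Turing.TM2.step, hc]
    rfl

end Prog

theorem finite_symbol : Finite Symbol := by
  let f : Symbol → Option Bool ⊕ Bool ⊕ Fin 3
    | .val v => .inl v
    | .leaf b => .inr (.inl b)
    | .tick => .inr (.inr 0)
    | .sep => .inr (.inr 1)
    | .branch => .inr (.inr 2)
  refine Finite.of_injective f fun a b h => ?_
  cases a <;> cases b <;> simp_all [f]

/-- The machine that runs a program, writes the flag to the output stack, and halts. -/
noncomputable def Prog.machine {K : Type} [DecidableEq K] [Fintype K] (p : Prog K) (inp : K) :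
    Turing.FinTM2 :=
  haveI := p.finite_label
  haveI := finite_symbol
  { K := Option K
    k₀ := some inp
    k₁ := none
    Γ := Prog.Alphabet K
    Λ := Option p.Label
    main := some p.entry
    ΛFin := Fintype.ofFinite _
    σ := Regs
    initialState := (false, none)
    σFin := Fintype.ofFinite _
    Γk₀Fin := Fintype.ofFinite Symbol
    m := fun l => match l with
      | none => .push none (fun v => v.1) (.load (fun _ => (false, none)) .halt)
      | some l => p.code some none l }

/-- A program that consumes its input, and leaves the answer in its flag within polynomial time,
gives a polynomial time Turing machine. -/
theorem computable_of_prog {A : Type} {enc : A → List Symbol} {f : A → Bool} {K : Type}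
    [DecidableEq K] [Fintype K] (p : Prog K) (inp : K) (q : Polynomial ℕ)
    (h : ∀ a, ∃ t ≤ q.eval (enc a).length, ∃ o,
      p.Runs ((false, none), update (fun _ => []) inp (enc a)) ((f a, o), fun _ => []) t) :
    Nonempty (Turing.TM2ComputableInPolyTime enc Computability.encodeBool f) := by
  refine ⟨{ tm := p.machine inp
            inputAlphabet := Equiv.refl Symbol
            outputAlphabet := Equiv.refl Bool
            time := q + 1
            outputsFun := fun a => ?_ }⟩
  have hex : ∃ t ≤ (q + 1).eval (enc a).length,
      (flip bind (p.machine inp).step)^[t] (some (Turing.initList (p.machine inp)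
        (List.map (Equiv.refl Symbol).invFun (enc a)))) =
      some (Turing.haltList (p.machine inp)
        (List.map (Equiv.refl Bool).invFun (Computability.encodeBool (f a)))) := by
    obtain ⟨t, ht, o, hr⟩ := h a
    refine ⟨1 + t, by simp; omega, ?_⟩
    have hs := hr.simulate (p.machine inp).m some none (fun l => rfl)
    have h0 : Turing.initList (p.machine inp) (List.map (Equiv.refl Symbol).invFun (enc a)) =
        Prog.cfg (some p.entry) ((false, none), update (fun _ => []) inp (enc a)) := by
      unfold Turing.initList Prog.cfg
      congr 1
      funext s
      cases s with
      | none => exact dif_neg (by simp [Prog.machine])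
      | some s =>
        by_cases hsi : s = inp
        · subst hsi
          refine (dif_pos rfl).trans ?_
          exact (List.map_id _).trans (update_self s (enc a) (fun _ => [])).symm
        · refine (dif_neg (by simpa [Prog.machine] using hsi)).trans ?_
          exact (update_of_ne hsi (enc a) (fun _ => [])).symm
    rw [h0, iterate_add_apply]
    refine (congrArg _ hs).trans ?_
    simp only [iterate_one, flip, Prog.cfg]
    change some (Turing.TM2.stepAux _ _ _) = _
    congr 1
    unfold Turing.haltList
    change Turing.TM2.Cfg.mk none (false, none) _ = _
    congr 1
    funext s
    cases s with
    | none =>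
      refine Eq.trans ?_ (dif_pos rfl).symm
      simp [Prog.withOutput, Computability.encodeBool]
      rfl
    | some s =>
      refine Eq.trans ?_ (dif_neg (by simp [Prog.machine])).symm
      exact update_of_ne (Option.some_ne_none s) _ _
  exact { steps := hex.choose
          evals_in_steps := hex.choose_spec.2
          steps_le_m := hex.choose_spec.1 }

/-! ### Basic stack programs -/

namespace Prog

variable {K : Type} [DecidableEq K]

/-- `p` leads from `a` to `b` within `T` steps. -/
def RunsIn (p : Prog K) (a b : Regs × Stacks K) (T : ℕ) : Prop :=
  ∃ t ≤ T, p.Runs a b t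

theorem RunsIn.congr {p : Prog K} {a b b' : Regs × Stacks K} {T T' : ℕ} (h : p.RunsIn a b T)
    (hb : b = b') (hT : T ≤ T') : p.RunsIn a b' T' :=
  let ⟨t, ht, hr⟩ := h
  ⟨t, ht.trans hT, hb ▸ hr⟩

theorem RunsIn.mono {p : Prog K} {a b : Regs × Stacks K} {T T' : ℕ} (h : p.RunsIn a b T)
    (hT : T ≤ T') : p.RunsIn a b T' :=
  h.congr rfl hT

theorem RunsIn.seq {p q : Prog K} {a b c : Regs × Stacks K} {T₁ T₂ : ℕ} (h₁ : p.RunsIn a b T₁)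
    (h₂ : q.RunsIn b c T₂) : (Prog.seq p q).RunsIn a c (T₁ + T₂) :=
  let ⟨_, ht₁, hr₁⟩ := h₁
  let ⟨_, ht₂, hr₂⟩ := h₂
  ⟨_, add_le_add ht₁ ht₂, .seq hr₁ hr₂⟩

theorem RunsIn.ite_true {c : Regs → Bool} {p q : Prog K} {a b : Regs × Stacks K} {T : ℕ}
    (hc : c a.1 = true) (h : p.RunsIn a b T) : (Prog.ite c p q).RunsIn a b (1 + T) :=
  let ⟨_, ht, hr⟩ := h
  ⟨_, by omega, .ite_true hc hr⟩

theorem RunsIn.ite_false {c : Regs → Bool} {p q : Prog K} {a b : Regs × Stacks K} {T : ℕ}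
    (hc : c a.1 = false) (h : q.RunsIn a b T) : (Prog.ite c p q).RunsIn a b (1 + T) :=
  let ⟨_, ht, hr⟩ := h
  ⟨_, by omega, .ite_false hc hr⟩

theorem RunsIn.loop_false {c : Regs → Bool} {p : Prog K} {a : Regs × Stacks K}
    (hc : c a.1 = false) : (Prog.loop c p).RunsIn a a 1 :=
  ⟨1, le_rfl, .loop_false hc⟩

theorem RunsIn.loop_true {c : Regs → Bool} {p : Prog K} {a b d : Regs × Stacks K} {T₁ T₂ : ℕ}
    (hc : c a.1 = true) (h₁ : p.RunsIn a b T₁) (h₂ : (Prog.loop c p).RunsIn b d T₂) :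
    (Prog.loop c p).RunsIn a d (1 + T₁ + T₂) :=
  let ⟨_, ht₁, hr₁⟩ := h₁
  let ⟨_, ht₂, hr₂⟩ := h₂
  ⟨_, by omega, .loop_true hc hr₁ hr₂⟩

theorem push_runsIn (s : K) (f : Regs → Symbol) (v : Regs) (S : Stacks K) :
    (push s f).RunsIn (v, S) (v, update S s (f v :: S s)) 1 :=
  ⟨1, le_rfl, .push s f v S⟩

theorem peek_runsIn (s : K) (f : Regs → Option Symbol → Regs) (v : Regs) (S : Stacks K) :
    (peek s f).RunsIn (v, S) (f v (S s).head?, S) 1 :=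
  ⟨1, le_rfl, .peek s f v S⟩

/-- Remove the top of a stack, remember it, and fold it into the flag. -/
def take (s : K) (g : Bool → Symbol → Bool) : Prog K :=
  .pop s fun v o => (o.elim v.1 (g v.1), o)

theorem take_nil {s : K} {g : Bool → Symbol → Bool} {v : Regs} {S : Stacks K} (hS : S s = []) :
    (take s g).RunsIn (v, S) ((v.1, none), S) 1 := by
  have h := Runs.pop s (fun v o => (o.elim v.1 (g v.1), o)) v S
  rw [hS, List.tail_nil, ← hS, update_eq_self] at h
  exact ⟨1, le_rfl, by simpa [hS, take] using h⟩

theorem take_cons {s : K} {g : Bool → Symbol → Bool} {v : Regs} {S : Stacks K} {x : Symbol}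
    {l : List Symbol} (hS : S s = x :: l) :
    (take s g).RunsIn (v, S) ((g v.1 x, some x), update S s l) 1 := by
  have h := Runs.pop s (fun v o => (o.elim v.1 (g v.1), o)) v S
  exact ⟨1, le_rfl, by simpa [hS, take] using h⟩

/-- Put the symbol that was read last on a stack. -/
def put (s : K) : Prog K :=
  .push s fun v => v.2.getD .tick

theorem put_runsIn (s : K) (b : Bool) (x : Symbol) (S : Stacks K) :
    (put s).RunsIn ((b, some x), S) ((b, some x), update S s (x :: S s)) 1 :=
  push_runsIn s _ _ S

/-- Repeat a program as long as the last attempt to read a symbol was successful. -/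
def whileSome (p : Prog K) : Prog K :=
  .loop (fun v => v.2.isSome) p

/-- Empty a stack, folding its symbols into the flag. -/
def drain (s : K) (g : Bool → Symbol → Bool) : Prog K :=
  .seq (take s g) (whileSome (take s g))

theorem drain_runsIn (s : K) (g : Bool → Symbol → Bool) (v : Regs) (S : Stacks K) :
    (drain s g).RunsIn (v, S) (((S s).foldl g v.1, none), update S s [])
      (2 * (S s).length + 2) := by
  have key : ∀ (l : List Symbol) (S : Stacks K) (b : Bool) (x : Symbol), S s = l →
      (whileSome (take s g)).RunsIn ((b, some x), S) ((l.foldl g b, none), update S s [])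
        (2 * l.length + 3) := by
    intro l
    induction l with
    | nil =>
      intro S b x hS
      refine (RunsIn.loop_true rfl (take_nil hS) (.loop_false rfl)).congr ?_ (by simp)
      rw [← hS, update_eq_self, hS]
      rfl
    | cons y l ih =>
      intro S b x hS
      have h := ih (update S s l) (g b y) y (by simp)
      rw [update_idem] at h
      exact (RunsIn.loop_true rfl (take_cons (g := g) (v := (b, some x)) hS) h).mono
        (by simp; omega)
  cases hS : S s with
  | nil =>
    refine (RunsIn.seq (take_nil hS) (.loop_false rfl)).congr ?_ (by simp)
    rw [← hS, update_eq_self, hS]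
    rfl
  | cons y l =>
    have h := key l (update S s l) (g v.1 y) y (by simp)
    rw [update_idem] at h
    exact (RunsIn.seq (take_cons hS) h).mono (by simp; omega)

/-- Empty a stack. -/
def clear (s : K) : Prog K :=
  drain s fun b _ => b

theorem clear_runsIn (s : K) (v : Regs) (S : Stacks K) :
    (clear s).RunsIn (v, S) ((v.1, none), update S s []) (2 * (S s).length + 2) := by
  have h := drain_runsIn s (fun b _ => b) v S
  rwa [List.foldl_const, show (fun b : Bool => b) = id from rfl, iterate_id, id] at h

/-- Move the symbols of `s` to `s'`, one by one and thus in reverse order. -/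
def move (s s' : K) : Prog K :=
  .seq (take s fun b _ => b) (whileSome (.seq (put s') (take s fun b _ => b)))

theorem move_runsIn {s s' : K} (hs : s' ≠ s) (v : Regs) (S : Stacks K) :
    (move s s').RunsIn (v, S) ((v.1, none), update (update S s []) s' ((S s).reverse ++ S s'))
      (3 * (S s).length + 2) := by
  have key : ∀ (l : List Symbol) (S : Stacks K) (x : Symbol), S s = l →
      (whileSome (.seq (put s') (take s fun b _ => b))).RunsIn ((v.1, some x), S)
        ((v.1, none), update (update S s []) s' (l.reverse ++ x :: S s')) (3 * l.length + 4) := by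
    intro l
    induction l with
    | nil =>
      intro S x hS
      refine (RunsIn.loop_true rfl (.seq (put_runsIn s' _ x S) (take_nil (by simp [hs.symm, hS])))
        (.loop_false rfl)).congr ?_ (by simp)
      rw [← hS, update_eq_self, hS]
      rfl
    | cons y l ih =>
      intro S x hS
      refine (RunsIn.loop_true rfl (.seq (put_runsIn s' _ x S) (take_cons (x := y) (l := l)
        (by simp [hs.symm, hS]))) (ih _ _ (by simp))).congr ?_ (by simp; omega)
      simp only [update_idem, update_comm hs, update_self, update_of_ne hs]
      simp
  cases hS : S s with
  | nil =>
    refine (RunsIn.seq (take_nil hS) (.loop_false rfl)).congr ?_ (by simp)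
    have h : update S s [] = S := by rw [← hS, update_eq_self]
    simp [h]
  | cons y l =>
    refine (RunsIn.seq (take_cons hS) (key l (update S s l) y (by simp))).congr ?_ (by simp; omega)
    simp [hs]

/-- The loop of `look`: it moves the symbols of `x` to `s`, and as many symbols of `y` to `s'`. -/
def lookLoop (x y s s' : K) : Prog K :=
  whileSome <| .seq (put s) <| .seq (take y fun b _ => b) <|
    .seq (.ite (fun v => v.2.isSome) (put s') (.peek s' fun v _ => v)) (take x fun b _ => b)

/-- Test by `f` the symbol of the stack `y` whose position is the height of the stack `x`, with
the help of two empty stacks. -/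
def look (x y s s' : K) (f : Option Symbol → Bool) : Prog K :=
  .seq (take x fun b _ => b) <| .seq (lookLoop x y s s') <|
    .seq (.peek y fun _ o => (f o, none)) <| .seq (move s x) (move s' y)

theorem look_runsIn {x y s s' : K} (hxy : x ≠ y) (hxs : x ≠ s) (hxs' : x ≠ s') (hys : y ≠ s)
    (hys' : y ≠ s') (hss : s ≠ s') (f : Option Symbol → Bool) (v : Regs) (S : Stacks K)
    (hs : S s = []) (hs' : S s' = []) :
    (look x y s s' f).RunsIn (v, S) ((f (S y)[(S x).length]?, none), S)
      (12 * (S x).length + 12) := by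
  have half : ∀ (S : Stacks K) (z : Symbol), (Prog.seq (put s) <| .seq (take y fun b _ => b) <|
      (.ite (fun v => v.2.isSome) (put s') (.peek s' fun v _ => v))).RunsIn ((v.1, some z), S)
      ((v.1, (S y).head?), update (update (update S s (z :: S s)) y (S y).tail) s'
        ((S y).head?.toList ++ S s')) 4 := by
    intro S z
    cases hy : S y with
    | nil =>
      refine (RunsIn.seq (put_runsIn s _ z S) (.seq (take_nil (by simp [hys, hy]))
        (.ite_false rfl (peek_runsIn _ _ _ _)))).congr ?_ (by simp)
      congr 1
      funext k
      simp only [update_apply]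
      split_ifs <;> simp_all
    | cons a l =>
      refine (RunsIn.seq (put_runsIn s _ z S) (.seq
        (take_cons (by simp [hys, hy]; exact ⟨rfl, rfl⟩))
        (.ite_true rfl (put_runsIn _ _ _ _)))).congr ?_ (by simp)
      simp [hss.symm, hys'.symm]
  have key : ∀ (l : List Symbol) (S S' : Stacks K) (z : Symbol), S x = l → S' x = [] →
      S' y = (S y).drop (l.length + 1) → S' s = l.reverse ++ z :: S s →
      S' s' = ((S y).take (l.length + 1)).reverse ++ S s' →
      (∀ k, k ≠ x → k ≠ y → k ≠ s → k ≠ s' → S' k = S k) →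
      (lookLoop x y s s').RunsIn ((v.1, some z), S) ((v.1, none), S') (6 * l.length + 7) := by
    have assoc : ∀ {p₁ p₂ p₃ p₄ : Prog K} {a b c T}, (Prog.seq p₁ (.seq p₂ p₃)).RunsIn a b T →
        p₄.RunsIn b c 1 → (Prog.seq p₁ (.seq p₂ (.seq p₃ p₄))).RunsIn a c (T + 1) := by
      rintro p₁ p₂ p₃ p₄ a b c T ⟨t, ht, hr⟩ ⟨t', ht', hr'⟩
      cases hr with
      | seq h₁ h₂ =>
      cases h₂ with
      | seq h₂ h₃ => exact ⟨_, by omega, .seq h₁ (.seq h₂ (.seq h₃ hr'))⟩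
    intro l
    induction l with
    | nil =>
      intro S S' z hx hx' hy' hs hs' hk
      refine (RunsIn.loop_true rfl (assoc (half S z) (take_nil (by simp [hxs, hxs', hxy, hx])))
        (.loop_false rfl)).congr ?_ (by simp)
      congr 1
      funext k
      simp only [update_apply]
      split_ifs with h1 h2 h3
      · rw [h1, hs']; cases S y <;> simp
      · rw [h2, hy']; simp
      · rw [h3, hs]; simp
      · by_cases h4 : k = x
        · rw [h4, hx', hx]
        · exact (hk k h4 h2 h3 h1).symm
    | cons a l ih =>
      intro S S' z hx hx' hy' hs hs' hk
      refine (RunsIn.loop_true rfl (assoc (half S z) (take_cons (x := a) (l := l)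
        (by simp [hxs, hxs', hxy, hx]))) (ih _ S' a (by simp) hx' ?_ ?_ ?_ ?_)).mono
        (by simp; omega)
      · rw [hy']
        simp [hxy.symm, hys']
      · rw [hs]
        simp [hxs.symm, hss, hys.symm]
      · rw [hs']
        simp [hxs'.symm, hxy.symm, hys']
        cases S y <;> simp
      · intro k h1 h2 h3 h4
        rw [hk k h1 h2 h3 h4]
        simp [h1, h2, h3, h4]
  set S' : Stacks K := update (update (update (update S x []) y ((S y).drop (S x).length)) s
    (S x).reverse) s' ((S y).take (S x).length).reverse with hS'
  have hlast : (Prog.seq (.peek y fun _ o => (f o, none)) <| .seq (move s x) (move s' y)).RunsIn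
      ((v.1, none), S') ((f (S y)[(S x).length]?, none), S) (6 * (S x).length + 5) := by
    refine (RunsIn.seq (peek_runsIn _ _ _ _) (.seq (move_runsIn hxs _ _)
      (move_runsIn hys' _ _))).congr ?_ ?_
    · refine Prod.ext ?_ ?_
      · simp [hS', hys, hys']
      · funext k
        simp only [update_apply, hS']
        split_ifs <;> simp_all
    · simp [hS', hxs'.symm, hss, hss.symm]
      omega
  cases hx : S x with
  | nil =>
    have hSS : S' = S := by
      rw [hS']
      rw [hx, List.length_nil, List.drop_zero, List.take_zero, List.reverse_nil, ← hx,
        update_eq_self, update_eq_self, hx, ← hs, update_eq_self, hs, ← hs', update_eq_self]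
    rw [hSS, hx] at hlast
    exact (RunsIn.seq (take_nil hx) (.seq (.loop_false rfl) hlast)).mono (by simp)
  | cons a l =>
    rw [hx] at hlast
    refine (RunsIn.seq (take_cons hx) (.seq (key l _ S' a (by simp) ?_ ?_ ?_ ?_ ?_) hlast)).mono
      (by simp; omega)
    · simp [hS', hxy, hxs, hxs']
    · simp [hS', hxy.symm, hys, hys', hx]
    · simp [hS', hxs.symm, hss, hs, hx]
    · simp [hS', hxs'.symm, hxy.symm, hs', hx]
    · intro k h1 h2 h3 h4
      simp [hS', h1, h2, h3, h4]

end Prog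

/-- The list that stands for a number. -/
abbrev ticks (m : ℕ) : List Symbol := List.replicate m .tick

/-- The test whether a symbol is `Symbol.leaf true`. -/
def isTrue : Option Symbol → Bool
  | some (.leaf b) => b
  | _ => false

namespace Prog

variable {K : Type} [DecidableEq K]

/-- The loop of `tabulate`. -/
def tabulateLoop (x r y s s' : K) (p : Prog K) : Prog K :=
  .loop (fun v => v.1) <| .seq p <| .seq (.push r fun v => .leaf v.1) <|
    .seq (.push x fun _ => .tick) (look x y s s' fun o => o.isSome)

/-- Run `p` for all heights of the stack `x` below the height of the stack `y`, and push the
answers to the stack `r`. -/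
def tabulate (x r y s s' : K) (p : Prog K) : Prog K :=
  .seq (look x y s s' fun o => o.isSome) <| .seq (tabulateLoop x r y s s' p) (clear x)

theorem tabulate_runsIn {x r y s s' : K} (hxy : x ≠ y) (hxs : x ≠ s) (hxs' : x ≠ s')
    (hys : y ≠ s) (hys' : y ≠ s') (hss : s ≠ s') (hrx : r ≠ x) (hry : r ≠ y) (hrs : r ≠ s)
    (hrs' : r ≠ s') {p : Prog K} (f : ℕ → Bool) (S : Stacks K) (T : ℕ) (hx : S x = [])
    (hr : S r = []) (hs : S s = []) (hs' : S s' = [])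
    (hp : ∀ m < (S y).length, ∀ v l,
      p.RunsIn (v, update (update S r l) x (ticks m))
        ((f m, none), update (update S r l) x (ticks m)) T) (v : Regs) :
    (tabulate x r y s s' p).RunsIn (v, S)
      ((false, none), update S r ((List.range (S y).length).map fun m => Symbol.leaf (f m)).reverse)
      (((S y).length + 1) * (T + 12 * (S y).length + 30)) := by
  set N := (S y).length with hN
  have hlook : ∀ m ≤ N, ∀ l v, (look x y s s' fun o => o.isSome).RunsIn
      (v, update (update S r l) x (ticks m))
      ((decide (m < N), none), update (update S r l) x (ticks m))
      (12 * N + 12) := by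
    intro m hm l v
    refine (look_runsIn hxy hxs hxs' hys hys' hss _ v _ ?_ ?_).congr ?_ ?_
    · simp [hxs.symm, hrs.symm, hs]
    · simp [hxs'.symm, hrs'.symm, hs']
    · simp only [update_of_ne hxy.symm, update_of_ne hry.symm, update_self, List.length_replicate]
      rw [Prod.mk.injEq, Prod.mk.injEq]
      exact ⟨⟨Bool.eq_iff_iff.mpr (by simp [← hN]), rfl⟩, rfl⟩
    · simpa using hm
  have key : ∀ j m, m + j = N → (tabulateLoop x r y s s' p).RunsIn
      ((decide (m < N), none), update (update S r
        ((List.range m).map fun m => Symbol.leaf (f m)).reverse) x (ticks m))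
      ((false, none), update (update S r
        ((List.range N).map fun m => Symbol.leaf (f m)).reverse) x (ticks N))
      (j * (T + 12 * N + 15) + 1) := by
    intro j
    induction j with
    | zero =>
      intro m hm
      obtain rfl : m = N := hm
      exact (RunsIn.loop_false (by simp)).congr (by simp) (by simp)
    | succ j ih =>
      intro m hm
      have hst : ∀ l : List Symbol, ∀ k k' : ℕ, update (update (update (update S r l) x (ticks k)) r
          (.leaf (f m) :: update (update S r l) x (ticks k) r)) x (ticks k') =
          update (update S r (.leaf (f m) :: l)) x (ticks k') := by
        intro l k k'
        rw [update_of_ne hrx, update_self,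
          update_comm (β := fun _ => List Symbol) hrx.symm (ticks k)
          (.leaf (f m) :: l), update_idem, update_idem]
      have hl := hlook (m + 1) (by omega) ((List.range (m + 1)).map fun m =>
          Symbol.leaf (f m)).reverse (f m, none)
      have hrange : ((List.range (m + 1)).map fun m => Symbol.leaf (f m)).reverse =
          .leaf (f m) :: ((List.range m).map fun m => Symbol.leaf (f m)).reverse := by
        simp [List.range_succ]
      rw [hrange, ← hst _ m] at hl
      have hi := ih (m + 1) (by omega)
      rw [hrange, ← hst _ m] at hi
      have hp2 := push_runsIn x (fun _ => Symbol.tick) (f m, none) (update (update (update S r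
        ((List.range m).map fun m => Symbol.leaf (f m)).reverse) x (ticks m)) r
          (.leaf (f m) :: update (update S r ((List.range m).map fun m =>
            Symbol.leaf (f m)).reverse) x (ticks m) r))
      rw [update_of_ne hrx.symm, update_self, ← List.replicate_succ] at hp2
      refine (RunsIn.loop_true (by simp; omega) (.seq (hp m (by omega) _ _)
        (.seq (push_runsIn _ _ _ _) (.seq hp2 hl))) hi).mono ?_
      rw [show (j + 1) * (T + 12 * N + 15) = j * (T + 12 * N + 15) + (T + 12 * N + 15) by ring]
      omega
  have h0 : S = update (update S r ((List.range 0).map fun m => Symbol.leaf (f m)).reverse) x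
      (ticks 0) := by
    rw [List.range_zero, List.map_nil, List.reverse_nil, ← hr, update_eq_self, ticks,
      List.replicate_zero, ← hx, update_eq_self]
  have hstart := hlook 0 (Nat.zero_le _) ((List.range 0).map fun m => Symbol.leaf (f m)).reverse v
  rw [← h0] at hstart
  have hloop := key N 0 (by simp)
  rw [← h0] at hloop
  refine (RunsIn.seq hstart (.seq hloop (clear_runsIn _ _ _))).congr ?_ ?_
  · congr 1
    rw [update_idem]
    funext k
    by_cases hk : k = x
    · subst hk; simp [hrx.symm, hx]
    · simp [hk]
  · simp only [update_self, List.length_replicate]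
    nlinarith

end Prog

/-! ### Bounded formulas over strings -/

/-- Formulas about a string of symbols, the word, with variables for lists of symbols. Such a list
stands for the number that is its length, or for the set of all numbers at which it has the symbol
`Symbol.leaf true`. All numbers are below the length of the word.

* `look x y f`: the test `f` holds for the symbol with number `x` of the list `y`, or of the word.
* `ex φ`: some number satisfies `φ`.
* `iter t x φ`: the number `x` belongs to the set that is reached from the empty set in `t` rounds,
  each of which replaces a set by the set of all numbers that satisfy `φ`. -/
inductive Expr : ℕ → Type
  | look {d : ℕ} (x : Fin d) (y : Option (Fin d)) (f : Option Symbol → Bool) : Expr d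
  | not {d : ℕ} (φ : Expr d) : Expr d
  | and {d : ℕ} (φ ψ : Expr d) : Expr d
  | ex {d : ℕ} (φ : Expr (d + 1)) : Expr d
  | iter {d : ℕ} (t x : Fin d) (φ : Expr (d + 2)) : Expr d

/-- Assignments of lists to `d` variables. -/
abbrev Lists (d : ℕ) : Type := Fin d → List Symbol

/-- Extend an assignment by a value for a new last variable. -/
abbrev Lists.extend {d : ℕ} (ρ : Lists d) (l : List Symbol) : Lists (d + 1) :=
  Fin.snoc (α := fun _ => List Symbol) ρ l

namespace Expr

/-- The truth value of a formula. -/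
def eval (w : List Symbol) : {d : ℕ} → Expr d → Lists d → Bool
  | _, look x y f, ρ => f (y.elim w ρ)[(ρ x).length]?
  | _, not φ, ρ => !φ.eval w ρ
  | _, and φ ψ, ρ => φ.eval w ρ && ψ.eval w ρ
  | _, ex φ, ρ => (List.range w.length).any fun m => φ.eval w (ρ.extend (ticks m))
  | _, iter t x φ, ρ =>
      isTrue ((fun R => (List.range w.length).map fun m =>
        Symbol.leaf (φ.eval w ((ρ.extend R).extend (ticks m))))^[(ρ t).length] [])[(ρ x).length]?

end Expr

/-! ### Polynomial time evaluation of bounded formulas -/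

namespace Expr

/-- A bound for the number of variables that are in scope anywhere in a formula. -/
def width : {d : ℕ} → Expr d → ℕ
  | d, look _ _ _ => d + 1
  | _, not φ => φ.width
  | _, and φ ψ => max φ.width ψ.width
  | _, ex φ => φ.width
  | _, iter _ _ φ => φ.width

theorem lt_width {d : ℕ} (φ : Expr d) : d < φ.width := by
  induction φ with
  | look => simp [width]
  | not φ ih => exact ih
  | and φ ψ ih _ => exact lt_max_of_lt_left ih
  | ex φ ih => exact (Nat.lt_succ_self _).trans ih
  | iter t x φ ih => exact (by omega : _ < _ + 2).trans ih

section Compile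

variable {K : Type} (loc : ℕ → Fin 3 → K)

/-- The stack of a variable or of the word. -/
def slot {d : ℕ} : Option (Fin d) → K
  | none => loc 0 0
  | some x => loc (x + 1) 0

/-- The program that evaluates a formula. The word is on the stack `loc 0 0` and variable `x` on the
stack `loc (x + 1) 0`. The other stacks hold intermediate results: those of `loc 0` belong to
`Prog.look`, and those of `loc (d + 1)` to the subformula that binds variable `d`. -/
def compile : {d : ℕ} → Expr d → Prog K
  | _, look x y f =>
      if y = some x then .peek (loc 0 0) fun _ _ => (f none, none)
      else Prog.look (slot loc (some x)) (slot loc y) (loc 0 1) (loc 0 2) f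
  | _, not φ => .seq φ.compile (.peek (loc 0 0) fun v _ => (!v.1, none))
  | _, and φ ψ => .seq φ.compile (.ite (fun v => v.1) ψ.compile (.peek (loc 0 0) fun v _ => v))
  | d, ex φ =>
      .seq (Prog.tabulate (loc (d + 1) 0) (loc (d + 1) 2) (loc 0 0) (loc 0 1) (loc 0 2) φ.compile)
        (Prog.drain (loc (d + 1) 2) fun b s => b || isTrue (some s))
  | d, iter t x φ =>
      let next := Prog.look (loc (d + 1) 1) (slot loc (some t)) (loc 0 1) (loc 0 2)
        fun o => o.isSome
      .seq next <| .seq (.loop (fun v => v.1) <|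
        .seq (Prog.tabulate (loc (d + 2) 0) (loc (d + 1) 2) (loc 0 0) (loc 0 1) (loc 0 2)
          φ.compile) <|
        .seq (Prog.clear (loc (d + 1) 0)) <| .seq (Prog.move (loc (d + 1) 2) (loc (d + 1) 0)) <|
        .seq (.push (loc (d + 1) 1) fun _ => .tick) next) <|
      .seq (Prog.clear (loc (d + 1) 1)) <|
      .seq (Prog.look (slot loc (some x)) (loc (d + 1) 0) (loc 0 1) (loc 0 2) isTrue) <|
      Prog.clear (loc (d + 1) 0)

/-- The stacks hold the word and the values of the variables, and the stacks that are needed for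
intermediate results are empty. Here `D` bounds the number of variables. -/
structure Holds (D : ℕ) {d : ℕ} (S : Stacks K) (w : List Symbol) (ρ : Lists d) : Prop where
  word : S (loc 0 0) = w
  aux₁ : S (loc 0 1) = []
  aux₂ : S (loc 0 2) = []
  var : ∀ x : Fin d, S (loc (x + 1) 0) = ρ x
  free : ∀ i a, d < i → i < D → S (loc i a) = []

end Compile

section Correct

variable {K : Type} [DecidableEq K] {loc : ℕ → Fin 3 → K} {D : ℕ}

theorem Holds.extend (hloc : ∀ i a j b, i < D → j < D → loc i a = loc j b → i = j ∧ a = b) {d : ℕ}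
    {S : Stacks K} {w : List Symbol} {ρ : Lists d} (h : Holds loc D S w ρ) (hd : d + 1 < D)
    (l : List Symbol) : Holds loc D (update S (loc (d + 1) 0) l) w (ρ.extend l) := by
  have ne : ∀ i a, i < D → (i ≠ d + 1 ∨ a ≠ 0) → loc i a ≠ loc (d + 1) 0 := fun i a hi hia heq => by
    have := hloc _ _ _ _ hi hd heq
    tauto
  refine ⟨?_, ?_, ?_, fun x => ?_, fun i a h₁ h₂ => ?_⟩
  · rw [update_of_ne (ne _ _ (by omega) (by simp)), h.word]
  · rw [update_of_ne (ne _ _ (by omega) (by simp)), h.aux₁]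
  · rw [update_of_ne (ne _ _ (by omega) (by simp)), h.aux₂]
  · induction x using Fin.lastCases with
    | last => simp [Lists.extend]
    | cast x =>
      rw [Fin.val_castSucc, update_of_ne (ne _ _ (by omega) (Or.inl (by omega))), h.var]
      simp [Lists.extend]
  · rw [update_of_ne (ne _ _ h₂ (Or.inl (by omega))), h.free i a (by omega) h₂]

theorem Holds.scratch (hloc : ∀ i a j b, i < D → j < D → loc i a = loc j b → i = j ∧ a = b) {d : ℕ}
    {S : Stacks K} {w : List Symbol} {ρ : Lists d} (h : Holds loc D S w ρ) (hd : d < D) {i : ℕ}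
    {a : Fin 3} (hi : 0 < i) (hid : i ≤ d) (ha : a ≠ 0) (l : List Symbol) :
    Holds loc D (update S (loc i a) l) w ρ := by
  have ne : ∀ j b, j < D → (j ≠ i ∨ b ≠ a) → loc j b ≠ loc i a := fun j b hj hjb heq => by
    have := hloc _ _ _ _ hj (hid.trans_lt hd) heq
    tauto
  refine ⟨?_, ?_, ?_, fun x => ?_, fun j b h₁ h₂ => ?_⟩
  · rw [update_of_ne (ne _ _ (by omega) (Or.inl (by omega))), h.word]
  · rw [update_of_ne (ne _ _ (by omega) (Or.inl (by omega))), h.aux₁]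
  · rw [update_of_ne (ne _ _ (by omega) (Or.inl (by omega))), h.aux₂]
  · rw [update_of_ne (ne _ _ (by omega) (Or.inr ha.symm)), h.var]
  · rw [update_of_ne (ne _ _ h₂ (Or.inl (by omega))), h.free j b h₁ h₂]

/-- A formula can be evaluated within a time that is polynomial in the lengths of the word and of
the values of the variables. All stacks are restored. -/
theorem compile_runsIn (hloc : ∀ i a j b, i < D → j < D → loc i a = loc j b → i = j ∧ a = b)
    {d : ℕ} (φ : Expr d) (hD : φ.width ≤ D) :
    ∃ q : Polynomial ℕ, ∀ (S : Stacks K) w (ρ : Lists d) (L : ℕ), Holds loc D S w ρ →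
      w.length ≤ L → (∀ x, (ρ x).length ≤ L) → ∀ v,
      (φ.compile loc).RunsIn (v, S) ((φ.eval w ρ, none), S) (q.eval L) := by
  have ne : ∀ {i a j b}, i < D → j < D → (i ≠ j ∨ a ≠ b) → loc i a ≠ loc j b :=
    fun {i a j b} hi hj hij heq => by
      have := hloc _ _ _ _ hi hj heq
      tauto
  have hdD := φ.lt_width.trans_le hD
  induction φ with
  | @look d x y f =>
    refine ⟨12 * Polynomial.X + 12, fun S w ρ L hS hw hρ v => ?_⟩
    by_cases hxy : y = some x
    · subst hxy
      rw [compile, if_pos rfl]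
      refine (Prog.peek_runsIn _ _ _ _).congr ?_ (by simp)
      simp [eval]
    · rw [compile, if_neg hxy]
      have hx := x.2
      have hS' : S (slot loc y) = y.elim w ρ := by
        cases y with
        | none => exact hS.word
        | some y => exact hS.var y
      refine (Prog.look_runsIn ?_ ?_ ?_ ?_ ?_ ?_ f v S hS.aux₁ hS.aux₂).congr ?_ ?_
      · cases y with
        | none => exact ne (by omega) (by omega) (by simp)
        | some y =>
          exact ne (by omega) (by omega) (Or.inl fun h =>
            hxy (by rw [Fin.ext (by omega : x.1 = y.1)]))
      · exact ne (by omega) (by omega) (by simp)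
      · exact ne (by omega) (by omega) (by simp)
      · cases y with
        | none => exact ne (by omega) (by omega) (by simp)
        | some y => exact ne (by omega) (by omega) (by simp)
      · cases y with
        | none => exact ne (by omega) (by omega) (by simp)
        | some y => exact ne (by omega) (by omega) (by simp)
      · exact ne (by omega) (by omega) (by simp)
      · rw [hS', slot, hS.var, eval]
      · rw [slot, hS.var]
        have := hρ x
        simp
        omega
  | not φ ih =>
    obtain ⟨q, hq⟩ := ih hD hdD
    refine ⟨q + 1, fun S w ρ L hS hw hρ v => ?_⟩
    exact ((hq S w ρ L hS hw hρ v).seq (Prog.peek_runsIn _ _ _ _)).congr (by simp [eval]) (by simp)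
  | and φ ψ ih₁ ih₂ =>
    obtain ⟨q₁, hq₁⟩ := ih₁ ((le_max_left _ _).trans hD) hdD
    obtain ⟨q₂, hq₂⟩ := ih₂ ((le_max_right _ _).trans hD) hdD
    refine ⟨q₁ + q₂ + 2, fun S w ρ L hS hw hρ v => ?_⟩
    have h₁ := hq₁ S w ρ L hS hw hρ v
    cases hφ : φ.eval w ρ with
    | false =>
      rw [hφ] at h₁
      exact (h₁.seq (.ite_false rfl (Prog.peek_runsIn _ _ _ _))).congr (by simp [eval, hφ])
        (by simp)
    | true =>
      rw [hφ] at h₁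
      exact (h₁.seq (.ite_true rfl (hq₂ S w ρ L hS hw hρ _))).congr (by simp [eval, hφ])
        (by simp; omega)
  | @ex d φ ih =>
    have hd := φ.lt_width.trans_le hD
    obtain ⟨q, hq⟩ := ih hD hd
    refine ⟨(Polynomial.X + 1) * (q + 12 * Polynomial.X + 30) + 2 * Polynomial.X + 2,
      fun S w ρ L hS hw hρ v => ?_⟩
    have htab := Prog.tabulate_runsIn (x := loc (d + 1) 0) (r := loc (d + 1) 2) (y := loc 0 0)
      (s := loc 0 1) (s' := loc 0 2) (p := φ.compile loc)
      (ne (by omega) (by omega) (by simp)) (ne (by omega) (by omega) (by simp))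
      (ne (by omega) (by omega) (by simp)) (ne (by omega) (by omega) (by simp))
      (ne (by omega) (by omega) (by simp)) (ne (by omega) (by omega) (by simp))
      (ne (by omega) (by omega) (by simp)) (ne (by omega) (by omega) (by simp))
      (ne (by omega) (by omega) (by simp)) (ne (by omega) (by omega) (by simp))
      (fun m => φ.eval w (ρ.extend (ticks m))) S (q.eval L) (hS.free _ _ (by omega) hd)
      (hS.free _ _ (by omega) hd) hS.aux₁ hS.aux₂ ?_ v
    · rw [hS.word] at htab
      refine (htab.seq (Prog.drain_runsIn _ _ _ _)).congr ?_ ?_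
      · refine Prod.ext (Prod.ext ?_ rfl) ?_
        · have hfold : ∀ (l : List Symbol) (b : Bool),
              l.foldl (fun b s => b || isTrue (some s)) b =
                (b || l.any fun s => isTrue (some s)) := by
            intro l
            induction l with
            | nil => simp
            | cons a l ih => intro b; simp [ih, Bool.or_assoc]
          simp only [update_self, hfold, List.any_reverse, Bool.false_or, eval, List.any_map]
          rfl
        · simp only [update_idem]
          rw [← hS.free (d + 1) 2 (by omega) hd, update_eq_self]
      · simp only [update_self, List.length_reverse, List.length_map, List.length_range]
        simp only [Polynomial.eval_add, Polynomial.eval_mul, Polynomial.eval_X, Polynomial.eval_one,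
          Polynomial.eval_ofNat]
        have : (w.length + 1) * (q.eval L + 12 * w.length + 30) ≤
          (L + 1) * (q.eval L + 12 * L + 30) := by gcongr
        omega
    · intro m hm v l
      rw [hS.word] at hm
      rw [update_comm (ne (by omega) (by omega) (by simp))]
      refine hq _ w _ L ((hS.extend hloc hd _).scratch hloc hd (by omega) le_rfl
        (by simp) l) hw ?_ v
      intro x
      induction x using Fin.lastCases with
      | last => simp [Lists.extend]; omega
      | cast x => simpa [Lists.extend] using hρ x
  | @iter d t x φ ih =>
    have hd := φ.lt_width.trans_le hD
    obtain ⟨q, hq⟩ := ih hD hd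
    refine ⟨(Polynomial.X + 1) * ((Polynomial.X + 1) * (q + 12 * Polynomial.X + 30) +
      60 * Polynomial.X + 60) + 60 * Polynomial.X + 60, fun S w ρ L hS hw hρ v => ?_⟩
    set F : List Symbol → List Symbol := fun R => (List.range w.length).map fun m =>
      Symbol.leaf (φ.eval w ((ρ.extend R).extend (ticks m))) with hF
    set C := loc (d + 1) 1 with hC
    set R := loc (d + 1) 0 with hR
    set R' := loc (d + 1) 2 with hR'
    have hRC : R ≠ C := ne (by omega) (by omega) (by simp)
    have hRR' : R ≠ R' := ne (by omega) (by omega) (by simp)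
    have hCR' : C ≠ R' := ne (by omega) (by omega) (by simp)
    have ht := t.2
    have hx := x.2
    have hlen : ∀ j, (F^[j] []).length ≤ L := by
      intro j
      cases j with
      | zero => simp
      | succ j => rw [iterate_succ_apply']; simpa [hF] using hw
    -- the state after `j` rounds
    let st : ℕ → Stacks K := fun j => update (update S R (F^[j] [])) C (ticks j)
    have hst : ∀ j, Holds loc D (st j) w (ρ.extend (F^[j] [])) := fun j =>
      (hS.extend hloc (by omega) _).scratch hloc (by omega) (by omega) le_rfl (by simp) _
    have hnext : ∀ j ≤ (ρ t).length, ∀ v, (Prog.look C (slot loc (some t)) (loc 0 1) (loc 0 2)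
        fun o => o.isSome).RunsIn (v, st j) ((decide (j < (ρ t).length), none), st j)
        (12 * L + 12) := by
      intro j hj v
      have h₁ : st j (slot loc (some t)) = ρ t :=
        ((hst j).var t.castSucc).trans (by simp [Lists.extend])
      have h₄ : st j C = ticks j := update_self ..
      refine (Prog.look_runsIn (x := C) (y := slot loc (some t))
        (ne (by omega) (by omega) (by simp))
        (ne (by omega) (by omega) (by simp)) (ne (by omega) (by omega) (by simp))
        (ne (by omega) (by omega) (by simp)) (ne (by omega) (by omega) (by simp))
        (ne (by omega) (by omega) (by simp)) _ v _ (hst j).aux₁ (hst j).aux₂).congr ?_ ?_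
      · rw [h₁, h₄, Prod.mk.injEq, Prod.mk.injEq]
        exact ⟨⟨Bool.eq_iff_iff.mpr (by simp), rfl⟩, rfl⟩
      · rw [h₄]
        have := hρ t
        simp
        omega
    have hround : ∀ j < (ρ t).length, ∀ v, (Prog.seq (Prog.tabulate
        (loc (d + 2) 0) R' (loc 0 0) (loc 0 1) (loc 0 2) (φ.compile loc)) <|
        .seq (Prog.clear R) <| .seq (Prog.move R' R) <|
        .seq (.push C fun _ => .tick) (Prog.look C (slot loc (some t)) (loc 0 1) (loc 0 2)
          fun o => o.isSome)).RunsIn (v, st j) ((decide (j + 1 < (ρ t).length), none), st (j + 1))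
        ((L + 1) * (q.eval L + 12 * L + 30) + 17 * L + 17) := by
      intro j hj v
      have hR0 : st j R' = [] := by
        simp only [st]
        rw [update_of_ne hCR'.symm, update_of_ne hRR'.symm, hS.free _ _ (by omega) (by omega)]
      have htab := Prog.tabulate_runsIn (x := loc (d + 2) 0) (r := R') (y := loc 0 0)
        (s := loc 0 1) (s' := loc 0 2) (p := φ.compile loc)
        (ne (by omega) (by omega) (by simp)) (ne (by omega) (by omega) (by simp))
        (ne (by omega) (by omega) (by simp)) (ne (by omega) (by omega) (by simp))
        (ne (by omega) (by omega) (by simp)) (ne (by omega) (by omega) (by simp))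
        (ne (by omega) (by omega) (by simp)) (ne (by omega) (by omega) (by simp))
        (ne (by omega) (by omega) (by simp)) (ne (by omega) (by omega) (by simp))
        (fun m => φ.eval w ((ρ.extend (F^[j] [])).extend (ticks m))) (st j) (q.eval L)
        ((hst j).free _ _ (by omega) hd) hR0 (hst j).aux₁ (hst j).aux₂ ?_ v
      · rw [(hst j).word] at htab
        set S₁ := update (st j) R' ((List.range w.length).map fun m => Symbol.leaf
          (φ.eval w ((ρ.extend (F^[j] [])).extend (ticks m)))).reverse with hS₁
        set S₂ := update S₁ R [] with hS₂
        set S₃ := update (update S₂ R' []) R ((S₂ R').reverse ++ S₂ R) with hS₃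
        have heq : update S₃ C (.tick :: S₃ C) = st (j + 1) := by
          simp only [hS₃, hS₂, hS₁, st, iterate_succ_apply']
          funext k
          by_cases hk1 : k = C
          · subst hk1; simp [hRC.symm, hCR', List.replicate_succ]
          by_cases hk2 : k = R
          · subst hk2; simp [hRC, hRR'.symm, hF]
          by_cases hk3 : k = R'
          · subst hk3
            simp [hRR'.symm, hCR'.symm]
            exact hS.free (d + 1) 2 (by omega) (by omega)
          · simp [hk1, hk2, hk3]
        have h₄ := Prog.push_runsIn C (fun _ => .tick) (false, none) S₃
        rw [heq] at h₄
        refine (htab.seq ((Prog.clear_runsIn R _ S₁).seq ((Prog.move_runsIn hRR' _ S₂).seq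
          (h₄.seq (hnext (j + 1) hj _))))).mono ?_
        have h₁ : S₁ R = F^[j] [] := by simp [hS₁, st, hRC, hRR']
        have h₂ : (S₂ R').length = w.length := by simp [hS₂, hS₁, hRR'.symm]
        rw [h₁, h₂]
        have := hlen j
        have : (w.length + 1) * (q.eval L + 12 * w.length + 30) ≤
            (L + 1) * (q.eval L + 12 * L + 30) := by gcongr
        omega
      · intro m hm v l
        rw [(hst j).word] at hm
        rw [update_comm (ne (by omega) (by omega) (by simp))]
        refine hq _ w _ L (((hst j).extend hloc hd _).scratch hloc hd
          (i := d + 1) (by omega) (by omega) (by simp) l)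
          hw ?_ v
        intro x
        induction x using Fin.lastCases with
        | last => simp [Lists.extend]; omega
        | cast x =>
          induction x using Fin.lastCases with
          | last => simpa [Lists.extend] using hlen j
          | cast x => simpa [Lists.extend] using hρ x
    have hloop : ∀ i j, j + i = (ρ t).length → (Prog.loop (fun v => v.1) (.seq (Prog.tabulate
        (loc (d + 2) 0) R' (loc 0 0) (loc 0 1) (loc 0 2) (φ.compile loc)) <| .seq (Prog.clear R) <|
        .seq (Prog.move R' R) <| .seq (.push C fun _ => .tick) (Prog.look C (slot loc (some t))
        (loc 0 1) (loc 0 2) fun o => o.isSome))).RunsIn ((decide (j < (ρ t).length), none), st j)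
        ((false, none), st (ρ t).length)
        (i * ((L + 1) * (q.eval L + 12 * L + 30) + 17 * L + 18) + 1) := by
      intro i
      induction i with
      | zero =>
        intro j hj
        obtain rfl : j = (ρ t).length := hj
        exact (Prog.RunsIn.loop_false (by simp)).congr (by simp) (by simp)
      | succ i ih =>
        intro j hj
        refine (Prog.RunsIn.loop_true (by simp; omega) (hround j (by omega) _)
          (ih (j + 1) (by omega))).mono ?_
        generalize (L + 1) * (q.eval L + 12 * L + 30) = B
        rw [add_one_mul]
        omega
    have hR0 : update S R [] = S := by
      rw [← hS.free (d + 1) 0 (by omega) (by omega), update_eq_self]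
    have hC0 : update S C [] = S := by
      rw [← hS.free (d + 1) 1 (by omega) (by omega), update_eq_self]
    have hst0 : st 0 = S := by
      simp only [st, iterate_zero, id, List.replicate_zero, hR0, hC0]
    have hfirst := hnext 0 (Nat.zero_le _) v
    have hrounds := hloop _ 0 (zero_add _)
    rw [hst0] at hfirst hrounds
    have hclear : update (st (ρ t).length) C [] = update S R (F^[(ρ t).length] []) := by
      simp only [st, update_idem]
      rw [update_comm hRC, hC0]
    have hlook : (Prog.look (slot loc (some x)) R (loc 0 1) (loc 0 2) isTrue).RunsIn
        ((false, none), update S R (F^[(ρ t).length] []))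
        (((iter t x φ).eval w ρ, none), update S R (F^[(ρ t).length] [])) (12 * L + 12) := by
      have hR := hS.extend hloc (by omega) (F^[(ρ t).length] [])
      have h₁ : update S R (F^[(ρ t).length] []) (slot loc (some x)) = ρ x :=
        (hR.var x.castSucc).trans (by simp [Lists.extend])
      refine (Prog.look_runsIn (x := slot loc (some x)) (y := R)
        (ne (by omega) (by omega) (Or.inl (by omega))) (ne (by omega) (by omega) (by simp))
        (ne (by omega) (by omega) (by simp)) (ne (by omega) (by omega) (by simp))
        (ne (by omega) (by omega) (by simp)) (ne (by omega) (by omega) (by simp)) _ _ _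
        hR.aux₁ hR.aux₂).congr ?_ ?_
      · rw [h₁, update_self, eval]
      · rw [h₁]
        have := hρ x
        omega
    have hend : update (update S R (F^[(ρ t).length] [])) R [] = S := by
      rw [update_idem, hR0]
    have hcl := Prog.clear_runsIn C (false, none) (st (ρ t).length)
    rw [hclear] at hcl
    refine (hfirst.seq (hrounds.seq (hcl.seq (hlook.seq (Prog.clear_runsIn R _ _))))).congr ?_ ?_
    · rw [hend]
    · simp only [st, update_self, Polynomial.eval_add, Polynomial.eval_mul, Polynomial.eval_X,
        Polynomial.eval_one, Polynomial.eval_ofNat, List.length_replicate]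
      have h₁ := hlen (ρ t).length
      have h₂ := hρ t
      have h₃ : (ρ t).length * ((L + 1) * (q.eval L + 12 * L + 30) + 17 * L + 18) ≤
        (L + 1) * ((L + 1) * (q.eval L + 12 * L + 30) + 60 * L + 60) := by
        gcongr <;> omega
      omega

end Correct

/-- A problem that is defined by a formula can be solved in polynomial time. -/
theorem computable (φ : Expr 0) {A : Type} (enc : A → List Symbol) (f : A → Bool)
    (hf : ∀ a, φ.eval (enc a) Fin.elim0 = f a) :
    Nonempty (Turing.TM2ComputableInPolyTime enc Computability.encodeBool f) := by
  have hD := φ.lt_width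
  have : NeZero φ.width := ⟨by omega⟩
  let loc : ℕ → Fin 3 → Fin φ.width × Fin 3 := fun i a => (Fin.ofNat φ.width i, a)
  have hloc : ∀ i a j b, i < φ.width → j < φ.width → loc i a = loc j b → i = j ∧ a = b := by
    intro i a j b hi hj h
    simpa [loc, Fin.ext_iff, Nat.mod_eq_of_lt hi, Nat.mod_eq_of_lt hj] using h
  obtain ⟨q, hq⟩ := compile_runsIn hloc φ le_rfl
  refine computable_of_prog (.seq (φ.compile loc) (.clear (loc 0 0))) (loc 0 0)
    (q + 2 * Polynomial.X + 2) fun a => ?_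
  have hne : ∀ i b, i < φ.width → (i ≠ 0 ∨ b ≠ 0) →
      update (fun _ => []) (loc 0 0) (enc a) (loc i b) = [] := by
    intro i b hi hib
    refine update_of_ne (fun h => ?_) _ _
    have := hloc _ _ _ _ hi hD h
    tauto
  have hr := hq (update (fun _ => []) (loc 0 0) (enc a)) (enc a) Fin.elim0 (enc a).length
    ⟨update_self .., hne _ _ hD (by simp), hne _ _ hD (by simp), fun x => x.elim0,
      fun i b h₁ h₂ => hne i b h₂ (Or.inl (by omega))⟩ le_rfl (fun x => x.elim0) (false, none)
  obtain ⟨t, ht, h⟩ := (hr.seq (Prog.clear_runsIn (loc 0 0) _ _)).congr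
    (b' := ((f a, none), fun _ => [])) (by rw [hf, update_idem, update_eq_self_iff.mpr rfl])
    (T' := (q + 2 * Polynomial.X + 2).eval (enc a).length) (by simp; omega)
  exact ⟨t, ht, none, h⟩

end Expr

/-! ### Definable predicates -/

/-- A predicate on the elements of a type of problem inputs and on assignments of lists is definable
if, over the codes of these elements, it is expressed by a formula. -/
def Definable {A : Type} (enc : A → List Symbol) {d : ℕ} (P : A → Lists d → Prop) : Prop :=
  ∃ φ : Expr d, ∀ a ρ, φ.eval (enc a) ρ = true ↔ P a ρ

/-- The set that is reached from the empty set in a given number of rounds, if each round replaces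
a set `R` by the set of all numbers below `N` that satisfy `Q R`. -/
def rounds (Q : (ℕ → Prop) → ℕ → Prop) (N : ℕ) : ℕ → ℕ → Prop
  | 0 => fun _ => False
  | t + 1 => fun m => m < N ∧ Q (rounds Q N t) m

theorem countP_take_lt_succ_iff (f : Option Symbol → Bool) (w : List Symbol) {m : ℕ}
    (hm : m ≤ w.length) (t : ℕ) : (w.take m).countP (fun s => f (some s)) < t + 1 ↔
      ∀ m' < m, f w[m']? = true → (w.take m').countP (fun s => f (some s)) < t := by
  induction m with
  | zero => simp
  | succ m ih =>
    rw [List.take_add_one, List.countP_append, List.getElem?_eq_getElem (by omega)]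
    have ih := ih (by omega)
    by_cases hf : f w[m]? = true
    · have hf' : f (some w[m]) = true := by rwa [List.getElem?_eq_getElem (by omega)] at hf
      have hmono : ∀ m' < m, (w.take m').countP (fun s => f (some s)) ≤
          (w.take m).countP (fun s => f (some s)) := fun m' hm' =>
        (List.take_sublist_take_left (by omega)).countP_le
      simp only [Option.toList_some, List.countP_cons, hf', List.countP_nil, if_true]
      constructor
      · intro h m' hm' _
        rcases Nat.lt_succ_iff_lt_or_eq.mp hm' with h' | rfl
        · exact (hmono m' h').trans_lt (by omega)
        · omega
      · intro h
        have := h m (by omega) hf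
        omega
    · have hf' : ¬ f (some w[m]) = true := by rwa [List.getElem?_eq_getElem (by omega)] at hf
      simp only [Option.toList_some, List.countP_cons, hf', List.countP_nil]
      refine ih.trans ⟨fun h m' hm' hm'' => ?_, fun h m' hm' => h m' (by omega)⟩
      rcases Nat.lt_succ_iff_lt_or_eq.mp hm' with h' | rfl
      · exact h m' h' hm''
      · exact absurd hm'' hf

namespace Definable

variable {A : Type} {enc : A → List Symbol} {d : ℕ}

theorem congr {P Q : A → Lists d → Prop} (h : Definable enc P) (hPQ : ∀ a ρ, P a ρ ↔ Q a ρ) :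
    Definable enc Q :=
  let ⟨φ, hφ⟩ := h
  ⟨φ, fun a ρ => (hφ a ρ).trans (hPQ a ρ)⟩

theorem not {P : A → Lists d → Prop} (h : Definable enc P) :
    Definable enc fun a ρ => ¬ P a ρ :=
  let ⟨φ, hφ⟩ := h
  ⟨.not φ, fun a ρ => by simp [Expr.eval, ← hφ]⟩

theorem and {P Q : A → Lists d → Prop} (hP : Definable enc P) (hQ : Definable enc Q) :
    Definable enc fun a ρ => P a ρ ∧ Q a ρ :=
  let ⟨φ, hφ⟩ := hP
  let ⟨ψ, hψ⟩ := hQ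
  ⟨.and φ ψ, fun a ρ => by simp [Expr.eval, ← hφ, ← hψ]⟩

theorem or {P Q : A → Lists d → Prop} (hP : Definable enc P) (hQ : Definable enc Q) :
    Definable enc fun a ρ => P a ρ ∨ Q a ρ :=
  (hP.not.and hQ.not).not.congr fun _ _ => by tauto

theorem imp {P Q : A → Lists d → Prop} (hP : Definable enc P) (hQ : Definable enc Q) :
    Definable enc fun a ρ => P a ρ → Q a ρ :=
  (hP.and hQ.not).not.congr fun _ _ => by tauto

theorem ex {P : A → Lists d → ℕ → Prop}
    (h : Definable enc fun a (ρ : Lists (d + 1)) => P a (fun x => ρ x.castSucc)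
      (ρ (Fin.last d)).length) :
    Definable enc fun a ρ => ∃ m < (enc a).length, P a ρ m := by
  obtain ⟨φ, hφ⟩ := h
  refine ⟨.ex φ, fun a ρ => ?_⟩
  simp [Expr.eval, hφ, Lists.extend]

theorem all {P : A → Lists d → ℕ → Prop}
    (h : Definable enc fun a (ρ : Lists (d + 1)) => P a (fun x => ρ x.castSucc)
      (ρ (Fin.last d)).length) :
    Definable enc fun a ρ => ∀ m < (enc a).length, P a ρ m :=
  (ex (P := fun a ρ m => ¬ P a ρ m) h.not).not.congr fun _ _ => by push Not; rfl

theorem const (p : Prop) : Definable enc fun _ (_ : Lists d) => p := by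
  have h : Definable enc fun _ (_ : Lists d) => False :=
    ⟨.ex (.look (Fin.last d) none fun _ => false), fun a ρ => by simp [Expr.eval]⟩
  by_cases hp : p
  · exact h.not.congr fun _ _ => by simp [hp]
  · exact h.congr fun _ _ => by simp [hp]

/-- Quantifiers over finite types that do not depend on the input. -/
theorem exFinite {ι : Type} [Finite ι] {P : ι → A → Lists d → Prop}
    (h : ∀ i, Definable enc (P i)) : Definable enc fun a ρ => ∃ i, P i a ρ := by
  have key : ∀ l : List ι, Definable enc fun a ρ => ∃ i ∈ l, P i a ρ := by
    intro l
    induction l with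
    | nil => exact (const False).congr (by simp)
    | cons i l ih => exact ((h i).or ih).congr (by simp)
  have := Fintype.ofFinite ι
  exact (key Finset.univ.toList).congr (by simp)

theorem allFinite {ι : Type} [Finite ι] {P : ι → A → Lists d → Prop}
    (h : ∀ i, Definable enc (P i)) : Definable enc fun a ρ => ∀ i, P i a ρ :=
  (exFinite fun i => (h i).not).not.congr fun _ _ => by push Not; rfl

/-- Existential quantification over several numbers at once. -/
theorem exTuple {n : ℕ} {P : A → Lists d → (Fin n → ℕ) → Prop}
    (h : Definable enc fun a (ρ : Lists (d + n)) => P a (fun x => ρ (x.castAdd n))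
      fun j => (ρ (j.natAdd d)).length) :
    Definable enc fun a ρ => ∃ g : Fin n → ℕ, (∀ j, g j < (enc a).length) ∧ P a ρ g := by
  induction n with
  | zero =>
    refine h.congr fun a ρ => ?_
    rw [Unique.exists_iff]
    simp only [IsEmpty.forall_iff, true_and]
    exact iff_of_eq (congrArg _ (Subsingleton.elim _ _))
  | succ n ih =>
    refine (ih (P := fun a ρ g => ∃ m < (enc a).length, P a ρ (Fin.snoc (α := fun _ => ℕ) g m))
      (ex (P := fun a (ρ : Lists (d + n)) m => P a (fun x => ρ (x.castAdd n))
        (Fin.snoc (α := fun _ => ℕ) (fun j => (ρ (j.natAdd d)).length) m))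
        (h.congr fun a ρ => iff_of_eq ?_))).congr fun a ρ => ?_
    · congr 1
      funext j
      induction j using Fin.lastCases with
      | last => simp
      | cast j => simp
    · constructor
      · rintro ⟨g, hg, m, hm, hP⟩
        refine ⟨_, fun j => ?_, hP⟩
        induction j using Fin.lastCases with
        | last => simpa using hm
        | cast j => simpa using hg j
      · rintro ⟨g, hg, hP⟩
        refine ⟨fun j => g j.castSucc, fun j => hg _, g (Fin.last n), hg _, ?_⟩
        convert hP
        funext j
        induction j using Fin.lastCases with
        | last => simp
        | cast j => simp

theorem symbol (x : Fin d) (f : Option Symbol → Bool) :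
    Definable enc fun a ρ => f (enc a)[(ρ x).length]? = true :=
  ⟨.look x none f, fun _ _ => Iff.rfl⟩

theorem symbolEq (x : Fin d) (s : Symbol) :
    Definable enc fun a ρ => (enc a)[(ρ x).length]? = some s := by
  classical
  exact (symbol x fun o => decide (o = some s)).congr (by simp)

theorem mem (x y : Fin d) :
    Definable enc fun _ ρ => isTrue (ρ y)[(ρ x).length]? = true :=
  ⟨.look x (some y) isTrue, fun _ _ => Iff.rfl⟩

theorem lt (x y : Fin d) : Definable enc fun _ ρ => (ρ x).length < (ρ y).length :=
  ⟨.look x (some y) fun o => o.isSome, fun a ρ => by simp [Expr.eval]⟩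

theorem le (x y : Fin d) : Definable enc fun _ ρ => (ρ x).length ≤ (ρ y).length :=
  (lt y x).not.congr (by simp)

theorem eq (x y : Fin d) : Definable enc fun _ ρ => (ρ x).length = (ρ y).length :=
  ((le x y).and (le y x)).congr fun _ _ => by omega

theorem ltLength (x : Fin d) : Definable enc fun a ρ => (ρ x).length < (enc a).length :=
  (symbol x fun o => o.isSome).congr (by simp)

theorem iter (t x : Fin d) {Q : A → Lists d → (ℕ → Prop) → ℕ → Prop}
    (h : Definable enc fun a (ρ : Lists (d + 2)) => Q a (fun x => ρ x.castSucc.castSucc)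
      (fun m => isTrue (ρ (Fin.last d).castSucc)[m]? = true) (ρ (Fin.last (d + 1))).length) :
    Definable enc fun a ρ => rounds (Q a ρ) (enc a).length (ρ t).length (ρ x).length := by
  obtain ⟨φ, hφ⟩ := h
  refine ⟨.iter t x φ, fun a ρ => ?_⟩
  beta_reduce
  rw [Expr.eval]
  generalize (ρ t).length = t
  generalize (ρ x).length = m
  induction t generalizing m with
  | zero => simp [rounds, isTrue]
  | succ t ih =>
    rw [iterate_succ_apply', rounds]
    by_cases hm : m < (enc a).length
    · simp only [hm, List.length_map, List.length_range, List.getElem?_eq_getElem, List.getElem_map,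
        List.getElem_range, true_and]
      refine (hφ a _).trans (iff_of_eq ?_)
      rw [← funext fun m => propext (ih m)]
      simp [Lists.extend]
    · simp [hm, isTrue]

theorem zero (x : Fin d) :
    Definable enc fun a ρ => (ρ x).length = 0 ∧ (ρ x).length < (enc a).length := by
  refine ((ltLength x).and (ex (P := fun a ρ m => m < (ρ x).length)
    (lt (Fin.last d) x.castSucc)).not).congr fun a ρ => ?_
  constructor
  · rintro ⟨h₁, h₂⟩
    refine ⟨?_, h₁⟩
    by_contra h
    exact h₂ ⟨0, by omega, by omega⟩
  · rintro ⟨h₁, h₂⟩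
    exact ⟨h₂, by simp [h₁]⟩

theorem succ (x y : Fin d) :
    Definable enc fun a ρ => (ρ x).length + 1 = (ρ y).length ∧
      (ρ y).length < (enc a).length := by
  refine (((ltLength y).and (lt x y)).and (ex (P := fun a ρ m => (ρ x).length < m ∧
    m < (ρ y).length) ((lt x.castSucc (Fin.last d)).and
      (lt (Fin.last d) y.castSucc))).not).congr fun a ρ => ?_
  constructor
  · rintro ⟨⟨h₁, h₂⟩, h₃⟩
    refine ⟨?_, h₁⟩
    by_contra h
    exact h₃ ⟨(ρ x).length + 1, by omega, by omega, by omega⟩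
  · rintro ⟨h₁, h₂⟩
    refine ⟨⟨h₂, by omega⟩, ?_⟩
    rintro ⟨m, _, h₃, h₄⟩
    omega

/-- Addition is definable, since the interval of length `y` that starts at `x` is reached in `y`
rounds from the empty set by adding `x` and all successors of elements. -/
theorem add (x y z : Fin d) :
    Definable enc fun a ρ => (ρ x).length + (ρ y).length = (ρ z).length ∧
      (ρ z).length < (enc a).length := by
  have key : ∀ {d : ℕ} (x y z : Fin d), Definable enc fun a ρ => (ρ z).length < (enc a).length ∧
      (ρ x).length ≤ (ρ z).length ∧ (ρ z).length < (ρ x).length + (ρ y).length := by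
    intro d x y z
    refine (iter y z (Q := fun a ρ R m => m = (ρ x).length ∨ ∃ m' < (enc a).length, R m' ∧
      m' + 1 = m ∧ m < (enc a).length) (or (eq _ x.castSucc.castSucc)
      (ex (P := fun a (ρ : Lists (d + 2)) m' => isTrue (ρ (Fin.last d).castSucc)[m']? = true ∧
        m' + 1 = (ρ (Fin.last (d + 1))).length ∧ (ρ (Fin.last (d + 1))).length < (enc a).length)
        (and (mem _ (Fin.last d).castSucc.castSucc) (succ _ (Fin.last (d + 1)).castSucc))))).congr
      fun a ρ => ?_
    generalize (ρ z).length = m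
    generalize (ρ y).length = t
    generalize (ρ x).length = s
    induction t generalizing m with
    | zero => exact iff_of_false id (by omega)
    | succ t ih =>
      simp only [rounds, ih]
      constructor
      · rintro ⟨h, rfl | ⟨m', h', h'', rfl, _⟩⟩ <;> omega
      · rintro ⟨h₁, h₂, h₃⟩
        refine ⟨h₁, ?_⟩
        by_cases hm : m = s
        · exact Or.inl hm
        · exact Or.inr ⟨m - 1, by omega, by omega, by omega, h₁⟩
  refine (and (and (ltLength z) (le x z)) (and (key x y z).not
    (all (P := fun a ρ m => m < (ρ z).length → (ρ x).length ≤ m → m < (enc a).length ∧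
      (ρ x).length ≤ m ∧ m < (ρ x).length + (ρ y).length)
      (imp (lt (Fin.last d) z.castSucc) (imp (le x.castSucc (Fin.last d))
        (key x.castSucc y.castSucc (Fin.last d))))))).congr fun a ρ => ?_
  constructor
  · rintro ⟨⟨h₁, h₂⟩, h₃, h₄⟩
    refine ⟨?_, h₁⟩
    by_contra h
    have := h₄ ((ρ z).length - 1) (by omega)
    omega
  · rintro ⟨h₁, h₂⟩
    refine ⟨⟨h₂, by omega⟩, by omega, fun m _ _ _ => ?_⟩
    omega

/-- Counting is definable: fewer than `t + 1` symbols before position `x` pass the test `f` if and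
only if fewer than `t` symbols before `x'` do, for each position `x' < x` of such a symbol. -/
theorem countLt (f : Option Symbol → Bool) (x t : Fin d) :
    Definable enc fun a ρ => (ρ x).length < (enc a).length ∧
      ((enc a).take (ρ x).length).countP (fun s => f (some s)) < (ρ t).length := by
  refine (iter t x (Q := fun a ρ R m => ∀ m' < (enc a).length, m' < m → f (enc a)[m']? = true →
    R m') (all (P := fun a (ρ : Lists (d + 2)) m' => m' < (ρ (Fin.last (d + 1))).length →
      f (enc a)[m']? = true → isTrue (ρ (Fin.last d).castSucc)[m']? = true)
      (imp (lt _ (Fin.last (d + 1)).castSucc) (imp (symbol _ f)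
        (mem _ (Fin.last d).castSucc.castSucc))))).congr fun a ρ => ?_
  generalize (ρ x).length = m
  generalize (ρ t).length = t
  generalize enc a = w
  induction t generalizing m with
  | zero => simp [rounds]
  | succ t ih =>
    simp only [rounds, ih]
    refine and_congr_right fun hm => ?_
    rw [countP_take_lt_succ_iff f w hm.le t]
    exact ⟨fun h m' hm' hf => (h m' (by omega) hm' hf).2,
      fun h m' hm'' hm' hf => ⟨hm'', h m' hm' hf⟩⟩

end Definable

/-! ### Reading codes of inputs -/

/-- The word `w` contains the code of the number `m` at position `p`. -/
def UnaryAt (w : List Symbol) (p m : ℕ) : Prop :=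
  (∀ q, p ≤ q → q < p + m → w[q]? = some .tick) ∧ w[p + m]? = some .sep

theorem unaryAt_iff {pre post : List Symbol} {m m' : ℕ} :
    UnaryAt (pre ++ (encodeNum m ++ post)) pre.length m' ↔ m' = m := by
  have hget : ∀ q, pre.length ≤ q → q ≤ pre.length + m →
      (pre ++ (encodeNum m ++ post))[q]? =
        some (if q < pre.length + m then Symbol.tick else .sep) := by
    intro q h₁ h₂
    rw [List.getElem?_append_right h₁, List.getElem?_append_left (by simp [encodeNum]; omega),
      encodeNum]
    split_ifs with h
    · rw [List.getElem?_append_left (by simp; omega), List.getElem?_replicate]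
      simp
      omega
    · rw [List.getElem?_append_right (by simp; omega)]
      simp [show q - pre.length - m = 0 by omega]
  constructor
  · rintro ⟨h₁, h₂⟩
    rcases lt_trichotomy m' m with h | h | h
    · rw [hget _ (by omega) (by omega), if_pos (by omega)] at h₂
      simp at h₂
    · exact h
    · have := h₁ (pre.length + m) (by omega) (by omega)
      rw [hget _ (by omega) (by omega), if_neg (by omega)] at this
      simp at this
  · rintro rfl
    refine ⟨fun q h₁ h₂ => ?_, ?_⟩
    · rw [hget _ h₁ h₂.le, if_pos h₂]
    · rw [hget _ (by omega) le_rfl, if_neg (by omega)]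

/-- Position `p` of the word `w` holds a symbol that passes the test `f`, and exactly `v` such
symbols precede it. -/
def NthAt (f : Option Symbol → Bool) (w : List Symbol) (v p : ℕ) : Prop :=
  f w[p]? = true ∧ p < w.length ∧ (w.take p).countP (fun s => f (some s)) = v

theorem NthAt.lt_count {f : Option Symbol → Bool} {w : List Symbol} {v p q : ℕ}
    (h : NthAt f w v p) (hpq : p < q) : v < (w.take q).countP (fun s => f (some s)) := by
  obtain ⟨h₁, h₂, rfl⟩ := h
  have h₃ : ((w.take (p + 1)).countP fun s => f (some s)) ≤ (w.take q).countP fun s => f (some s) :=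
    (List.take_sublist_take_left hpq).countP_le
  rw [List.getElem?_eq_getElem h₂] at h₁
  rw [List.take_add_one, List.countP_append, List.getElem?_eq_getElem h₂] at h₃
  simp only [Option.toList_some, List.countP_cons, List.countP_nil, h₁, if_true] at h₃
  omega

theorem NthAt.unique {f : Option Symbol → Bool} {w : List Symbol} {v p q : ℕ}
    (hp : NthAt f w v p) (hq : NthAt f w v q) : p = q := by
  have h₁ := hp.lt_count (q := q)
  have h₂ := hq.lt_count (q := p)
  rw [hp.2.2] at h₂
  rw [hq.2.2] at h₁
  omega

namespace Definable

variable {A : Type} {enc : A → List Symbol} {d : ℕ}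

theorem addSucc (x y z : Fin d) :
    Definable enc fun a ρ => (ρ x).length + (ρ y).length + 1 = (ρ z).length ∧
      (ρ z).length < (enc a).length := by
  refine congr (P := fun a ρ => ∃ s < (enc a).length, ((ρ x).length + (ρ y).length = s ∧
    s < (enc a).length) ∧ (s + 1 = (ρ z).length ∧ (ρ z).length < (enc a).length)) ?_ ?_
  · apply ex
    exact and (add x.castSucc y.castSucc (Fin.last d)) (succ (Fin.last d) z.castSucc)
  · intro a ρ
    constructor
    · rintro ⟨s, _, ⟨h₁, _⟩, h₂, h₃⟩
      exact ⟨by omega, h₃⟩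
    · rintro ⟨h₁, h₂⟩
      exact ⟨_, by omega, ⟨rfl, by omega⟩, h₁, h₂⟩

theorem unaryAt (x m : Fin d) :
    Definable enc fun a ρ => UnaryAt (enc a) (ρ x).length (ρ m).length := by
  refine congr (P := fun a ρ => ∃ e < (enc a).length, ((ρ x).length + (ρ m).length = e ∧
    e < (enc a).length) ∧ (enc a)[e]? = some .sep ∧ ∀ q < (enc a).length, (ρ x).length ≤ q →
      q < e → (enc a)[q]? = some .tick) ?_ ?_
  · apply ex
    refine and (add x.castSucc m.castSucc (Fin.last d)) (and (symbolEq _ _) ?_)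
    apply all
    exact imp (le x.castSucc.castSucc (Fin.last _)) (imp (lt (Fin.last _) (Fin.last d).castSucc)
      (symbolEq _ _))
  · intro a ρ
    constructor
    · rintro ⟨e, he, ⟨rfl, _⟩, h₁, h₂⟩
      exact ⟨fun q hq hq' => h₂ q (by omega) hq hq', h₁⟩
    · rintro ⟨h₁, h₂⟩
      have h := (List.getElem?_eq_some_iff.mp h₂).1
      exact ⟨_, h, ⟨rfl, h⟩, h₂, fun q _ hq hq' => h₁ q hq hq'⟩

theorem nthAt (f : Option Symbol → Bool) (v p : Fin d) :
    Definable enc fun a ρ => NthAt f (enc a) (ρ v).length (ρ p).length := by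
  refine congr (P := fun a ρ => f (enc a)[(ρ p).length]? = true ∧ (ρ p).length < (enc a).length ∧
    (¬ ((ρ p).length < (enc a).length ∧
      ((enc a).take (ρ p).length).countP (fun s => f (some s)) < (ρ v).length)) ∧
    ∀ q < (enc a).length, q < (ρ p).length → f (enc a)[q]? = true → q < (enc a).length ∧
      ((enc a).take q).countP (fun s => f (some s)) < (ρ v).length) ?_ ?_
  · refine and (symbol p f) (and (ltLength p) (and (countLt f p v).not ?_))
    apply all
    exact imp (lt (Fin.last d) p.castSucc) (imp (symbol (Fin.last d) f)
      (countLt f (Fin.last d) v.castSucc))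
  · intro a ρ
    refine and_congr_right fun h₁ => and_congr_right fun h₂ => ?_
    constructor
    · rintro ⟨h₃, h₄⟩
      refine le_antisymm (Nat.lt_succ_iff.mp ?_) (by simpa [h₂] using h₃)
      exact (countP_take_lt_succ_iff f _ h₂.le _).mpr fun q hq hf => (h₄ q (by omega) hq hf).2
    · rintro h
      refine ⟨by omega, fun q hq hq' hf => ⟨hq, ?_⟩⟩
      have hn : NthAt f (enc a) _ q := ⟨hf, hq, rfl⟩
      exact h ▸ hn.lt_count hq'

end Definable

/-! ### Definability of the parts of an input -/

/-- The test for the first symbols of codes of nodes. -/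
def isLabel : Option Symbol → Bool
  | some (.leaf _) => true
  | some .branch => true
  | _ => false

/-- The test for components of instances. -/
def isVal : Option Symbol → Bool
  | some (.val _) => true
  | _ => false

section Encoding

variable {C : BDDClass} {k : ℕ}

theorem exists_split_finRange {n : ℕ} (v : Fin n) (f : Fin n → List Symbol) :
    (List.finRange n).flatMap f = ((List.finRange n).take v).flatMap f ++
      (f v ++ ((List.finRange n).drop (v + 1)).flatMap f) := by
  conv_lhs => rw [← List.take_append_drop v (List.finRange n), List.flatMap_append,
    List.drop_eq_getElem_cons (by simp), List.flatMap_cons]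
  simp

theorem countP_encodeNode {n s : ℕ} (u : Node n (Fin s)) :
    (encodeNode u).countP (fun s => isLabel (some s)) = 1 := by
  cases u <;> simp [encodeNode, encodeNum, isLabel, List.countP_append, List.countP_replicate]

theorem countP_flatMap_encodeNode {n s : ℕ} (node : Fin s → Node n (Fin s)) (l : List (Fin s)) :
    (l.flatMap fun v => encodeNode (node v)).countP (fun s => isLabel (some s)) = l.length := by
  induction l with
  | nil => simp
  | cons v l ih => rw [List.flatMap_cons, List.countP_append, countP_encodeNode, ih]; simp; omega

/-- The part of the code of an input that precedes the instances. -/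
def header (a : EvalInput C k) : List Symbol :=
  encodeNum a.dim ++ encodeNum a.model.root
    ++ (List.finRange a.model.size).flatMap (fun v => encodeNode (a.model.node v)) ++ [.sep]

theorem exists_nthAt_isLabel (a : EvalInput C k) (u : Fin a.model.size) :
    ∃ pre post, encodeInput a = pre ++ (encodeNode (a.model.node u) ++ post) ∧
      NthAt isLabel (encodeInput a) u pre.length := by
  have hnum : ∀ m, (encodeNum m).countP (fun s => isLabel (some s)) = 0 := fun m => by
    simp [encodeNum, isLabel, List.countP_replicate]
  have heq : encodeInput a = (encodeNum a.dim ++ encodeNum a.model.root ++ ((List.finRange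
      a.model.size).take u).flatMap fun v => encodeNode (a.model.node v)) ++
      (encodeNode (a.model.node u) ++ (((List.finRange a.model.size).drop (u + 1)).flatMap
      (fun v => encodeNode (a.model.node v)) ++ [.sep] ++
      (List.finRange k).flatMap fun j => encodeInstance (a.inst j))) := by
    rw [encodeInput, exists_split_finRange u fun v => encodeNode (a.model.node v)]
    simp only [List.append_assoc]
  refine ⟨_, _, heq, ?_⟩
  rw [heq]
  generalize hpre : encodeNum a.dim ++ encodeNum a.model.root ++ ((List.finRange
      a.model.size).take u).flatMap (fun v => encodeNode (a.model.node v)) = pre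
  refine ⟨?_, ?_, ?_⟩
  · rw [List.getElem?_append_right le_rfl, Nat.sub_self]
    cases a.model.node u <;> rfl
  · cases a.model.node u <;> simp [encodeNode]
  · rw [List.take_left, ← hpre]
    simp [List.countP_append, hnum, countP_flatMap_encodeNode]

theorem nthAt_isLabel (a : EvalInput C k) {v p : ℕ} (h : NthAt isLabel (encodeInput a) v p) :
    ∃ u : Fin a.model.size, u.val = v ∧ ∃ pre post,
      encodeInput a = pre ++ (encodeNode (a.model.node u) ++ post) ∧ pre.length = p := by
  have hnum : ∀ m, (encodeNum m).countP (fun s => isLabel (some s)) = 0 := fun m => by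
    simp [encodeNum, isLabel, List.countP_replicate]
  have hinst : ∀ l : List (Fin k), (l.flatMap fun j => encodeInstance (a.inst j)).countP
      (fun s => isLabel (some s)) = 0 := fun l => by
    induction l with
    | nil => simp
    | cons j l ih =>
      rw [List.flatMap_cons, List.countP_append, ih]
      simp [encodeInstance, isLabel]
  have hv : v < a.model.size := by
    have h₁ := h.lt_count h.2.1
    rw [List.take_length, encodeInput] at h₁
    simp only [List.countP_append, hnum, hinst, countP_flatMap_encodeNode] at h₁
    simpa [isLabel] using h₁
  obtain ⟨pre, post, heq, hn⟩ := exists_nthAt_isLabel a ⟨v, hv⟩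
  exact ⟨⟨v, hv⟩, rfl, pre, post, heq, hn.unique h⟩

theorem encodeInput_eq_header (a : EvalInput C k) : encodeInput a =
    header a ++ (List.finRange k).flatMap fun j => encodeInstance (a.inst j) :=
  rfl

/-- The position of the first component of an instance. -/
def instanceStart (a : EvalInput C k) (j : ℕ) : ℕ :=
  (header a).length + j * (a.dim + 1)

theorem getElem?_instance (a : EvalInput C k) (j : Fin k) (i : Fin a.dim) :
    (encodeInput a)[instanceStart a j + i]? = some (.val (a.inst j i)) := by
  rw [encodeInput_eq_header, exists_split_finRange j, instanceStart]
  have hlen : ∀ l : List (Fin k), (l.flatMap fun j => encodeInstance (a.inst j)).length =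
      l.length * (a.dim + 1) := by
    intro l
    induction l with
    | nil => simp
    | cons j l ih => rw [List.flatMap_cons, List.length_append, ih]; simp [encodeInstance]; ring
  have hj := j.2
  rw [List.getElem?_append_right (by omega), List.getElem?_append_right (by
      rw [hlen, List.length_take, List.length_finRange, min_eq_left hj.le]; omega),
    List.getElem?_append_left, hlen, List.length_take, List.length_finRange, min_eq_left hj.le,
    show (header a).length + j * (a.dim + 1) + i - (header a).length - j * (a.dim + 1) = i by omega,
    encodeInstance, List.getElem?_append_left (by simp)]
  · simp
  · rw [hlen, List.length_take, List.length_finRange, min_eq_left hj.le]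
    simp [encodeInstance]
    omega

theorem instanceStart_add_lt (a : EvalInput C k) (j : Fin k) (i : Fin a.dim) :
    instanceStart a j + i < (encodeInput a).length :=
  (List.getElem?_eq_some_iff.mp (getElem?_instance a j i)).1

theorem nthAt_isVal (a : EvalInput C k) (hk : 0 < k) :
    NthAt isVal (encodeInput a) 0 (header a).length := by
  have h := getElem?_instance a ⟨0, hk⟩ ⟨0, a.dim_pos⟩
  simp only [instanceStart, zero_mul, add_zero] at h
  refine ⟨by rw [h]; rfl, (List.getElem?_eq_some_iff.mp h).1, ?_⟩
  rw [encodeInput_eq_header, List.take_left, List.countP_eq_zero]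
  intro s hs
  have hval : ∀ s, isVal (some s) = true → ∃ v, s = .val v := fun s hs => by
    cases s <;> simp_all [isVal]
  have hnode : ∀ v, ∀ s ∈ encodeNode (a.model.node v), ¬ isVal (some s) = true := by
    intro v s hs hs'
    obtain ⟨o, rfl⟩ := hval s hs'
    cases hv : a.model.node v <;> simp [hv, encodeNode, encodeNum] at hs
  intro hs'
  simp only [header, List.mem_append, List.mem_flatMap] at hs
  obtain ⟨o, rfl⟩ := hval s hs'
  rcases hs with ((hs | hs) | ⟨v, -, hs⟩) | hs
  · simp [encodeNum] at hs
  · simp [encodeNum] at hs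
  · exact hnode v _ hs hs'
  · simp at hs

end Encoding

namespace Definable

variable {C : BDDClass} {k d : ℕ}

/-- Predicates on inputs and assignments that are definable over the codes of inputs. -/
abbrev OnInputs (P : EvalInput C k → Lists d → Prop) : Prop :=
  Definable encodeInput P

theorem dim (x : Fin d) :
    OnInputs fun (a : EvalInput C k) ρ => (ρ x).length = a.dim := by
  refine congr (P := fun a ρ => ∃ z < (encodeInput a).length,
    (z = 0 ∧ z < (encodeInput a).length) ∧ UnaryAt (encodeInput a) z (ρ x).length) ?_ ?_
  · apply ex
    exact and (zero (Fin.last d)) (unaryAt (Fin.last d) x.castSucc)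
  · intro a ρ
    have h : UnaryAt (encodeInput a) 0 (ρ x).length ↔ (ρ x).length = a.dim := by
      have := unaryAt_iff (pre := []) (m := a.dim) (m' := (ρ x).length)
        (post := encodeNum a.model.root ++ (List.finRange a.model.size).flatMap
          (fun v => encodeNode (a.model.node v)) ++ [.sep] ++
          (List.finRange k).flatMap fun j => encodeInstance (a.inst j))
      rw [← this, encodeInput]
      simp only [List.append_assoc, List.nil_append, List.length_nil]
    rw [← h]
    constructor
    · rintro ⟨z, _, ⟨rfl, _⟩, h⟩
      exact h
    · intro h
      have := (List.getElem?_eq_some_iff.mp h.2).1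
      exact ⟨0, by omega, ⟨rfl, by omega⟩, h⟩

theorem root (x : Fin d) :
    OnInputs fun (a : EvalInput C k) ρ => (ρ x).length = a.model.root := by
  refine congr (P := fun a ρ => ∃ n < (encodeInput a).length, n = a.dim ∧
    ∃ p < (encodeInput a).length, (n + 1 = p ∧ p < (encodeInput a).length) ∧
      UnaryAt (encodeInput a) p (ρ x).length) ?_ ?_
  · apply ex
    refine and (dim (Fin.last d)) ?_
    apply ex
    exact and (succ (Fin.last d).castSucc (Fin.last _)) (unaryAt (Fin.last _) x.castSucc.castSucc)
  · intro a ρ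
    have h : UnaryAt (encodeInput a) (a.dim + 1) (ρ x).length ↔
        (ρ x).length = a.model.root := by
      have := unaryAt_iff (pre := encodeNum a.dim) (m := a.model.root) (m' := (ρ x).length)
        (post := (List.finRange a.model.size).flatMap
          (fun v => encodeNode (a.model.node v)) ++ [.sep] ++
          (List.finRange k).flatMap fun j => encodeInstance (a.inst j))
      rw [← this, encodeInput]
      simp [encodeNum]
    rw [← h]
    constructor
    · rintro ⟨_, _, rfl, _, _, ⟨rfl, _⟩, h⟩
      exact h
    · intro h
      have := (List.getElem?_eq_some_iff.mp h.2).1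
      exact ⟨_, by omega, rfl, _, by omega, ⟨rfl, by omega⟩, h⟩

theorem leaf (b : Bool) (x : Fin d) :
    OnInputs fun (a : EvalInput C k) ρ =>
      ∃ v, v.val = (ρ x).length ∧ a.model.node v = .leaf b := by
  refine congr (P := fun a ρ => ∃ p < (encodeInput a).length,
    NthAt isLabel (encodeInput a) (ρ x).length p ∧ (encodeInput a)[p]? = some (.leaf b)) ?_ ?_
  · apply ex
    exact and (nthAt _ x.castSucc (Fin.last d)) (symbolEq (Fin.last d) _)
  · intro a ρ
    have hget : ∀ {pre post : List Symbol} {v}, encodeInput a = pre ++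
        (encodeNode (a.model.node v) ++ post) → ((encodeInput a)[pre.length]? = some (.leaf b) ↔
          a.model.node v = .leaf b) := by
      intro pre post v h
      rw [h, List.getElem?_append_right le_rfl, Nat.sub_self]
      cases a.model.node v <;> simp [encodeNode]
    constructor
    · rintro ⟨p, _, hp, hb⟩
      obtain ⟨v, hv, pre, post, h, rfl⟩ := nthAt_isLabel a hp
      exact ⟨v, hv, (hget h).mp hb⟩
    · rintro ⟨v, hv, hb⟩
      obtain ⟨pre, post, h, hn⟩ := exists_nthAt_isLabel a v
      exact ⟨_, hn.2.1, hv ▸ hn, (hget h).mpr hb⟩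

theorem edge (b : Bool) (x i y : Fin d) :
    OnInputs fun (a : EvalInput C k) ρ => ∃ v f next, a.model.node v = .branch f next ∧
      v.val = (ρ x).length ∧ f.val = (ρ i).length ∧ (next b).val = (ρ y).length := by
  refine congr (P := fun a ρ => ∃ p < (encodeInput a).length,
    NthAt isLabel (encodeInput a) (ρ x).length p ∧ (encodeInput a)[p]? = some .branch ∧
    ∃ p₁ < (encodeInput a).length, (p + 1 = p₁ ∧ p₁ < (encodeInput a).length) ∧
      UnaryAt (encodeInput a) p₁ (ρ i).length ∧
    ∃ p₂ < (encodeInput a).length, (p₁ + (ρ i).length + 1 = p₂ ∧ p₂ < (encodeInput a).length) ∧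
    ∃ t₀ < (encodeInput a).length, UnaryAt (encodeInput a) p₂ t₀ ∧
    ∃ p₃ < (encodeInput a).length, (p₂ + t₀ + 1 = p₃ ∧ p₃ < (encodeInput a).length) ∧
    ∃ t₁ < (encodeInput a).length, UnaryAt (encodeInput a) p₃ t₁ ∧
      (ρ y).length = if b then t₁ else t₀) ?_ ?_
  · apply ex
    refine and (nthAt _ x.castSucc (Fin.last d)) (and (symbolEq (Fin.last d) _) ?_)
    apply ex
    refine and (succ (Fin.last d).castSucc (Fin.last _)) (and (unaryAt (Fin.last _)
      i.castSucc.castSucc) ?_)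
    apply ex
    refine and (addSucc (Fin.last (d + 1)).castSucc i.castSucc.castSucc.castSucc (Fin.last _)) ?_
    apply ex
    refine and (unaryAt (Fin.last (d + 2)).castSucc (Fin.last (d + 3))) ?_
    apply ex
    refine and (addSucc (Fin.last (d + 2)).castSucc.castSucc (Fin.last (d + 3)).castSucc
      (Fin.last (d + 4))) ?_
    apply ex
    refine and (unaryAt (Fin.last (d + 4)).castSucc (Fin.last (d + 5))) ?_
    cases b
    · exact eq y.castSucc.castSucc.castSucc.castSucc.castSucc.castSucc
        (Fin.last (d + 3)).castSucc.castSucc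
    · exact eq y.castSucc.castSucc.castSucc.castSucc.castSucc.castSucc (Fin.last (d + 5))
  · intro a ρ
    -- the parts of the code of an internal node
    have parts : ∀ {pre post : List Symbol} {f : Fin a.dim} {next : Bool → Fin a.model.size},
        encodeInput a = pre ++ (encodeNode (.branch f next) ++ post) →
        (∀ m, UnaryAt (encodeInput a) (pre.length + 1) m ↔ m = f) ∧
        (∀ m, UnaryAt (encodeInput a) (pre.length + 1 + f + 1) m ↔ m = next false) ∧
        (∀ m, UnaryAt (encodeInput a) (pre.length + 1 + f + 1 + next false + 1) m ↔
          m = next true) := by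
      intro pre post f next h
      have h₁ := fun m => unaryAt_iff (pre := pre ++ [.branch]) (m := f) (m' := m)
        (post := encodeNum (next false) ++ encodeNum (next true) ++ post)
      have h₂ := fun m => unaryAt_iff (pre := pre ++ [.branch] ++ encodeNum f)
        (m := next false) (m' := m) (post := encodeNum (next true) ++ post)
      have h₃ := fun m => unaryAt_iff (pre := pre ++ [.branch] ++ encodeNum f ++
        encodeNum (next false)) (m := next true) (m' := m) (post := post)
      refine ⟨fun m => (iff_of_eq ?_).trans (h₁ m), fun m => (iff_of_eq ?_).trans (h₂ m),
        fun m => (iff_of_eq ?_).trans (h₃ m)⟩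
      · congr 1
        · simp [h, encodeNode]
        · simp
      · congr 1
        · simp [h, encodeNode]
        · simp [encodeNum]; omega
      · congr 1
        · simp [h, encodeNode]
        · simp [encodeNum]; omega
    constructor
    · rintro ⟨p, _, hp, hb, _, _, ⟨rfl, _⟩, h₁, _, _, ⟨rfl, _⟩, t₀, _, h₂, _, _, ⟨rfl, _⟩, t₁, _,
        h₃, hy⟩
      obtain ⟨v, hv, pre, post, h, rfl⟩ := nthAt_isLabel a hp
      cases hnode : a.model.node v with
      | leaf b' =>
        rw [h, List.getElem?_append_right le_rfl, Nat.sub_self, hnode] at hb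
        simp [encodeNode] at hb
      | branch f next =>
        rw [hnode] at h
        obtain ⟨e₁, e₂, e₃⟩ := parts h
        have hf := (e₁ _).mp h₁
        rw [hf, e₂] at h₂
        rw [hf, h₂, e₃] at h₃
        refine ⟨v, f, next, hnode, hv, hf.symm, ?_⟩
        rw [hy]
        cases b <;> simp [h₂, h₃]
    · rintro ⟨v, f, next, hnode, hv, hf, hy⟩
      obtain ⟨pre, post, h, hn⟩ := exists_nthAt_isLabel a v
      rw [hnode] at h
      obtain ⟨e₁, e₂, e₃⟩ := parts h
      have b₁ := (List.getElem?_eq_some_iff.mp ((e₁ _).mpr rfl).2).1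
      have b₂ := (List.getElem?_eq_some_iff.mp ((e₂ _).mpr rfl).2).1
      have b₃ := (List.getElem?_eq_some_iff.mp ((e₃ _).mpr rfl).2).1
      refine ⟨pre.length, hn.2.1, hv ▸ hn, ?_, pre.length + 1, by omega, ⟨rfl, by omega⟩,
        (e₁ _).mpr hf.symm, _, ?_, ⟨rfl, ?_⟩, next false, by omega, ?_, _, ?_, ⟨rfl, ?_⟩,
        next true, by omega, ?_, ?_⟩
      · rw [h, List.getElem?_append_right le_rfl, Nat.sub_self]
        rfl
      · omega
      · omega
      · rw [← hf]; exact (e₂ _).mpr rfl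
      · omega
      · omega
      · rw [← hf]; exact (e₃ _).mpr rfl
      · rw [← hy]
        cases b <;> rfl

theorem instanceStart {j : ℕ} (hj : j < k) (x : Fin d) :
    OnInputs fun (a : EvalInput C k) ρ => (ρ x).length = FOIL.instanceStart a j := by
  have hlt : ∀ (a : EvalInput C k) {j}, j < k → FOIL.instanceStart a j < (encodeInput a).length :=
    fun a j hj => instanceStart_add_lt a ⟨j, hj⟩ ⟨0, a.dim_pos⟩
  induction j generalizing d with
  | zero =>
    refine congr (P := fun a ρ => ∃ z < (encodeInput a).length,
      (z = 0 ∧ z < (encodeInput a).length) ∧ NthAt isVal (encodeInput a) z (ρ x).length) ?_ ?_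
    · apply ex
      exact and (zero (Fin.last d)) (nthAt _ (Fin.last d) x.castSucc)
    · intro a ρ
      have h := nthAt_isVal a hj
      rw [FOIL.instanceStart, zero_mul, add_zero]
      constructor
      · rintro ⟨_, _, ⟨rfl, _⟩, h'⟩
        exact h'.unique h
      · intro hx
        have := h.2.1
        exact ⟨0, by omega, ⟨rfl, by omega⟩, hx ▸ h⟩
  | succ j ih =>
    refine congr (P := fun a ρ => ∃ p < (encodeInput a).length, p = FOIL.instanceStart a j ∧
      ∃ n < (encodeInput a).length, n = a.dim ∧ p + n + 1 = (ρ x).length ∧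
        (ρ x).length < (encodeInput a).length) ?_ ?_
    · apply ex
      refine and (ih (by omega) (Fin.last d)) ?_
      apply ex
      exact and (dim (Fin.last (d + 1))) (addSucc (Fin.last d).castSucc (Fin.last (d + 1))
        x.castSucc.castSucc)
    · intro a ρ
      have h : FOIL.instanceStart a (j + 1) = FOIL.instanceStart a j + a.dim + 1 := by
        simp only [FOIL.instanceStart]; ring
      have hl := hlt a hj
      constructor
      · rintro ⟨_, _, rfl, _, _, rfl, h', _⟩
        omega
      · intro hx
        exact ⟨_, by omega, rfl, _, by omega, rfl, by omega, by omega⟩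

theorem component (j : Fin k) (o : Option Bool) (x : Fin d) :
    OnInputs fun (a : EvalInput C k) ρ => ∃ i, i.val = (ρ x).length ∧ a.inst j i = o := by
  refine congr (P := fun a ρ => ∃ n < (encodeInput a).length, n = a.dim ∧ (ρ x).length < n ∧
    ∃ p < (encodeInput a).length, p = FOIL.instanceStart a j ∧
    ∃ q < (encodeInput a).length, (p + (ρ x).length = q ∧ q < (encodeInput a).length) ∧
      (encodeInput a)[q]? = some (.val o)) ?_ ?_
  · apply ex
    refine and (dim (Fin.last d)) (and (lt x.castSucc (Fin.last d)) ?_)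
    apply ex
    refine and (instanceStart j.2 (Fin.last (d + 1))) ?_
    apply ex
    exact and (add (Fin.last (d + 1)).castSucc x.castSucc.castSucc.castSucc (Fin.last (d + 2)))
      (symbolEq (Fin.last (d + 2)) _)
  · intro a ρ
    constructor
    · rintro ⟨_, _, rfl, hi, _, _, rfl, _, _, ⟨rfl, _⟩, h⟩
      rw [show (ρ x).length = (⟨_, hi⟩ : Fin a.dim).val from rfl, getElem?_instance] at h
      exact ⟨⟨_, hi⟩, rfl, by simpa using h⟩
    · rintro ⟨i, hi, ho⟩
      have h := getElem?_instance a j i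
      have hl := instanceStart_add_lt a j i
      have hdim : a.dim < (encodeInput a).length := by
        simp [encodeInput, encodeNum]
      rw [hi] at h hl
      exact ⟨_, hdim, rfl, by omega, _, by omega, rfl, _, hl, ⟨rfl, hl⟩, ho ▸ h⟩

end Definable

/-! ### Paths in free diagrams -/

namespace BDD

variable {n : ℕ} (M : BDD n)

theorem Step.edge {M : BDD n} {x : Instance n} {u v : Fin M.size} (h : M.Step x u v) :
    Edge M.node u v :=
  let ⟨i, next, h₁, h₂⟩ := h
  ⟨x i, i, next, h₁, h₂⟩

theorem exists_leaf (x : Instance n) (u : Fin M.size) :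
    ∃ v b, Relation.ReflTransGen (M.Step x) u v ∧ M.node v = .leaf b := by
  have hwf : WellFounded fun v u => Relation.TransGen (Edge M.node) u v := by
    have : IsTrans (Fin M.size) fun v u => Relation.TransGen (Edge M.node) u v :=
      ⟨fun _ _ _ h₁ h₂ => h₂.trans h₁⟩
    have : Std.Irrefl fun v u : Fin M.size => Relation.TransGen (Edge M.node) u v :=
      ⟨M.acyclic⟩
    exact Finite.wellFounded_of_trans_of_irrefl _
  induction u using hwf.induction with
  | _ u ih =>
    cases hu : M.node u with
    | leaf b => exact ⟨u, b, .refl, hu⟩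
    | branch i next =>
      have hs : M.Step x u (next (x i)) := ⟨i, next, hu, rfl⟩
      obtain ⟨v, b, hv, hb⟩ := ih _ (.single hs.edge)
      exact ⟨v, b, .head hs hv, hb⟩

theorem eval_eq_of_path {x : Instance n} {v : Fin M.size} {b : Bool}
    (h : Relation.ReflTransGen (M.Step x) M.root v) (hb : M.node v = .leaf b) : M.eval x = b := by
  have hdet : Relator.RightUnique (M.Step x) := by
    rintro u v w ⟨i, next, hu, rfl⟩ ⟨i', next', hu', rfl⟩
    rw [hu] at hu'
    cases hu'
    rfl
  have hleaf : ∀ {v w b}, M.node v = .leaf b → Relation.ReflTransGen (M.Step x) v w → w = v := by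
    intro v w b hv hw
    rcases hw.cases_head with rfl | ⟨u, ⟨i, next, hu, _⟩, _⟩
    · rfl
    · rw [hv] at hu
      cases hu
  have heval : M.eval x = true ↔
      ∃ v, Relation.ReflTransGen (M.Step x) M.root v ∧ M.node v = .leaf true := by
    simp [eval]
  cases b with
  | true => exact heval.mpr ⟨v, h, hb⟩
  | false =>
    refine Bool.eq_false_iff.mpr fun h' => ?_
    obtain ⟨w, hw, hw'⟩ := heval.mp h'
    rcases Relation.ReflTransGen.total_of_right_unique hdet h hw with h' | h'
    · rw [hleaf hb h', hb] at hw'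
      cases hw'
    · rw [hleaf hw' h', hw'] at hb
      cases hb

/-- A step along an edge that leaves a node labelled `i` with a label `b` such that `P i b`. -/
def StepIn (P : Fin n → Bool → Prop) (u v : Fin M.size) : Prop :=
  ∃ i next b, M.node u = .branch i next ∧ P i b ∧ next b = v

/-- A leaf labelled `b` can be reached from `u` if only edge labels are allowed that satisfy `P`. -/
def Reaches (P : Fin n → Bool → Prop) (b : Bool) (u : Fin M.size) : Prop :=
  ∃ v, Relation.ReflTransGen (M.StepIn P) u v ∧ M.node v = .leaf b

theorem reaches_of_eval {P : Fin n → Bool → Prop} {x : Instance n} (h : ∀ i, P i (x i)) :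
    M.Reaches P (M.eval x) M.root := by
  obtain ⟨v, b, hv, hb⟩ := M.exists_leaf x M.root
  rw [M.eval_eq_of_path hv hb]
  exact ⟨v, Relation.ReflTransGen.mono
    (fun u w ⟨i, next, hu, hw⟩ => ⟨i, next, x i, hu, h i, hw⟩) _ _ hv, hb⟩

/-- In a free diagram every path can be realized by an instance, since it asks for the value of each
feature at most once. -/
theorem exists_eval_of_reaches {M : BDD n} (hM : M.IsFree) {P : Fin n → Bool → Prop}
    (hP : ∀ i, ∃ b, P i b) {b : Bool} (h : M.Reaches P b M.root) :
    ∃ x : Instance n, (∀ i, P i (x i)) ∧ M.eval x = b := by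
  obtain ⟨v, hv, hb⟩ := h
  suffices h : ∃ x : Instance n, (∀ i, P i (x i)) ∧
      Relation.ReflTransGen (M.Step x) M.root v from
    let ⟨x, hx, hx'⟩ := h
    ⟨x, hx, M.eval_eq_of_path hx' hb⟩
  generalize M.root = r at hv ⊢
  induction hv using Relation.ReflTransGen.head_induction_on with
  | refl =>
    choose x hx using hP
    exact ⟨x, hx, .refl⟩
  | @head u w hu _ ih =>
    obtain ⟨i, next, c, hu, hc, rfl⟩ := hu
    obtain ⟨x, hx, hpath⟩ := ih
    refine ⟨update x i c, fun j => ?_, ?_⟩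
    · by_cases hj : j = i
      · subst hj; simpa using hc
      · simpa [hj] using hx j
    · refine .head ⟨i, next, hu, congrArg next (update_self ..)⟩ ?_
      -- below `u`, the feature `i` does not occur any more
      have key : ∀ w, Relation.ReflTransGen (M.Step x) (next c) w →
          Relation.ReflTransGen (Edge M.node) (next c) w ∧
            Relation.ReflTransGen (M.Step (update x i c)) (next c) w := by
        intro w hw
        induction hw with
        | refl => exact ⟨.refl, .refl⟩
        | @tail w w' _ hs ih =>
          refine ⟨ih.1.tail hs.edge, ih.2.tail ?_⟩
          obtain ⟨j, next', hw, hw'⟩ := hs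
          refine ⟨j, next', hw, ?_⟩
          have hj : j ≠ i := by
            rintro rfl
            exact hM u w j (.head' ⟨c, j, next, hu, rfl⟩ ih.1) ⟨next, hu⟩ ⟨next', hw⟩
          simpa [hj] using hw'
      exact (key v hpath).2

/-- The number of nodes below a node. It decreases along edges. -/
noncomputable def rank (u : Fin M.size) : ℕ :=
  Set.ncard {v | Relation.TransGen (Edge M.node) u v}

theorem rank_lt_rank {u v : Fin M.size} (h : Edge M.node u v) : M.rank v < M.rank u :=
  Set.ncard_lt_ncard ⟨fun _ hw => .head h hw, fun hs => M.acyclic v (hs (.single h))⟩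

theorem rank_lt_size (u : Fin M.size) : M.rank u < M.size := by
  have h : {v | Relation.TransGen (Edge M.node) u v} ⊂ Set.univ :=
    ⟨Set.subset_univ _, fun hs => M.acyclic u (hs (Set.mem_univ u))⟩
  have := Set.ncard_lt_ncard h
  rwa [Set.ncard_univ, Nat.card_eq_fintype_card, Fintype.card_fin] at this

end BDD

/-! ### Existential formulas and atomic types -/

/-- Truth values of the atoms `x ⊆ y` and `Pos(x)` for all variables in `V`. -/
abbrev AtomicType (V : Type) : Type := (V → V → Prop) × (V → Prop)

/-- The atomic type of an assignment of partial instances. -/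
def atomicType {n : ℕ} {V : Type} (M : Instance n → Bool) (ν : V → PartialInstance n) :
    AtomicType V :=
  (fun x y => Subsumed (ν x) (ν y), fun x => IsPos M (ν x))

/-- The atomic type that results from a substitution of variables. -/
def AtomicType.comap {V W : Type} (f : V → W) (τ : AtomicType W) : AtomicType V :=
  (fun x y => τ.1 (f x) (f y), fun x => τ.2 (f x))

theorem atomicType_comp {n : ℕ} {V W : Type} (M : Instance n → Bool) (f : V → W)
    (ν : W → PartialInstance n) : atomicType M (ν ∘ f) = (atomicType M ν).comap f :=
  rfl

theorem subsumed_antisymm {n : ℕ} {e₁ e₂ : PartialInstance n} :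
    e₁ = e₂ ↔ Subsumed e₁ e₂ ∧ Subsumed e₂ e₁ := by
  constructor
  · rintro rfl
    exact ⟨fun _ _ => rfl, fun _ _ => rfl⟩
  · rintro ⟨h₁, h₂⟩
    funext i
    by_cases h : e₁ i = none
    · by_contra h'
      exact h' (h₂ i fun h'' => h' (h.trans h''.symm)).symm
    · exact h₁ i h

/-- The truth value of a quantifier-free formula in an atomic type. -/
def Formula.HoldsAt : {k : ℕ} → Formula k → AtomicType (Fin k) → Prop
  | _, eq x y, τ => τ.1 x y ∧ τ.1 y x
  | _, pos x, τ => τ.2 x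
  | _, sub x y, τ => τ.1 x y
  | _, not φ, τ => ¬ φ.HoldsAt τ
  | _, or φ ψ, τ => φ.HoldsAt τ ∨ ψ.HoldsAt τ
  | _, and φ ψ, τ => φ.HoldsAt τ ∧ ψ.HoldsAt τ
  | _, ex _, _ => False
  | _, all _, _ => False

theorem Formula.sat_iff_holdsAt {n : ℕ} (M : Instance n → Bool) {k : ℕ} (φ : Formula k)
    (hφ : φ.QuantifierFree) (ν : Fin k → PartialInstance n) :
    φ.Sat M ν ↔ φ.HoldsAt (atomicType M ν) := by
  induction φ with
  | eq x y => exact subsumed_antisymm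
  | pos x => exact Iff.rfl
  | sub x y => exact Iff.rfl
  | not φ ih => exact not_congr (ih hφ ν)
  | or φ ψ ih₁ ih₂ => exact or_congr (ih₁ hφ.1 ν) (ih₂ hφ.2 ν)
  | and φ ψ ih₁ ih₂ => exact and_congr (ih₁ hφ.1 ν) (ih₂ hφ.2 ν)
  | ex φ => exact hφ.elim
  | all φ => exact hφ.elim

/-- A predicate is existential if it says that there are partial instances which, together with the
given ones, have an atomic type from a fixed set. -/
def IsExistentialPred {k : ℕ}
    (P : ∀ n : ℕ, (Instance n → Bool) → (Fin k → PartialInstance n) → Prop) : Prop :=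
  ∃ (J : Type) (_ : Finite J) (T : Set (AtomicType (Fin k ⊕ J))), ∀ n M ν,
    P n M ν ↔ ∃ ν' : J → PartialInstance n, atomicType M (Sum.elim ν ν') ∈ T

namespace IsExistentialPred

variable {k : ℕ} {P Q : ∀ n : ℕ, (Instance n → Bool) → (Fin k → PartialInstance n) → Prop}

theorem congr (h : IsExistentialPred P) (hPQ : ∀ n M ν, P n M ν ↔ Q n M ν) :
    IsExistentialPred Q :=
  let ⟨J, hJ, T, hT⟩ := h
  ⟨J, hJ, T, fun n M ν => (hPQ n M ν).symm.trans (hT n M ν)⟩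

theorem of_atomicType (S : Set (AtomicType (Fin k))) :
    IsExistentialPred fun _ M (ν : Fin k → _) => atomicType M ν ∈ S :=
  ⟨Empty, inferInstance, {τ | τ.comap Sum.inl ∈ S}, fun _ _ _ =>
    ⟨fun h => ⟨Empty.elim, h⟩, fun ⟨_, h⟩ => h⟩⟩

theorem combine (c : Prop → Prop → Prop) (hc : ∀ {α β : Type} [Nonempty α] [Nonempty β]
      (p : α → Prop) (q : β → Prop), c (∃ a, p a) (∃ b, q b) ↔ ∃ a b, c (p a) (q b))
    (hP : IsExistentialPred P) (hQ : IsExistentialPred Q) :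
    IsExistentialPred fun n M ν => c (P n M ν) (Q n M ν) := by
  obtain ⟨J₁, hJ₁, T₁, h₁⟩ := hP
  obtain ⟨J₂, hJ₂, T₂, h₂⟩ := hQ
  refine ⟨J₁ ⊕ J₂, inferInstance, {τ | c (τ.comap (Sum.map id Sum.inl) ∈ T₁)
    (τ.comap (Sum.map id Sum.inr) ∈ T₂)}, fun n M ν => ?_⟩
  have e₁ : ∀ ν' : J₁ ⊕ J₂ → PartialInstance n,
      Sum.elim ν ν' ∘ Sum.map id Sum.inl = Sum.elim ν (ν' ∘ Sum.inl) := fun ν' => by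
    ext (_ | _) <;> rfl
  have e₂ : ∀ ν' : J₁ ⊕ J₂ → PartialInstance n,
      Sum.elim ν ν' ∘ Sum.map id Sum.inr = Sum.elim ν (ν' ∘ Sum.inr) := fun ν' => by
    ext (_ | _) <;> rfl
  beta_reduce
  rw [h₁, h₂, hc]
  simp only [Set.mem_ofPred_eq, ← atomicType_comp, e₁, e₂]
  constructor
  · rintro ⟨ν₁, ν₂, h⟩
    exact ⟨Sum.elim ν₁ ν₂, h⟩
  · rintro ⟨ν', h⟩
    exact ⟨_, _, h⟩

theorem or (hP : IsExistentialPred P) (hQ : IsExistentialPred Q) :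
    IsExistentialPred fun n M ν => P n M ν ∨ Q n M ν :=
  combine Or (fun p q => by simp [exists_or]) hP hQ

theorem and (hP : IsExistentialPred P) (hQ : IsExistentialPred Q) :
    IsExistentialPred fun n M ν => P n M ν ∧ Q n M ν :=
  combine And (fun p q => by simp) hP hQ

theorem ex {P : ∀ n : ℕ, (Instance n → Bool) → (Fin (k + 1) → PartialInstance n) → Prop}
    (hP : IsExistentialPred P) : IsExistentialPred fun n M (ν : Fin k → PartialInstance n) =>
      ∃ a, P n M (Fin.snoc (α := fun _ : Fin (k + 1) => PartialInstance n) ν a) := by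
  obtain ⟨J, hJ, T, h⟩ := hP
  let f : Fin (k + 1) ⊕ J → Fin k ⊕ Option J :=
    Sum.elim (Fin.lastCases (Sum.inr none) Sum.inl) (Sum.inr ∘ some)
  refine ⟨Option J, inferInstance, {τ | τ.comap f ∈ T}, fun n M ν => ?_⟩
  have e : ∀ ν' : Option J → PartialInstance n, Sum.elim ν ν' ∘ f =
      Sum.elim (Fin.snoc (α := fun _ : Fin (k + 1) => PartialInstance n) ν (ν' none))
        (ν' ∘ some) := fun ν' => by
    funext x
    rcases x with x | x
    · induction x using Fin.lastCases <;> simp [f]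
    · rfl
  simp only [h, Set.mem_ofPred_eq, ← atomicType_comp, e]
  constructor
  · rintro ⟨a, ν', h⟩
    exact ⟨fun j => j.elim a ν', h⟩
  · rintro ⟨ν', h⟩
    exact ⟨_, _, h⟩

theorem sat_of_quantifierFree (φ : Formula k) (hφ : φ.QuantifierFree) :
    IsExistentialPred fun _ M ν => φ.Sat M ν :=
  (of_atomicType {τ | φ.HoldsAt τ}).congr fun _ M ν => (φ.sat_iff_holdsAt M hφ ν).symm

theorem not_sat_of_quantifierFree (φ : Formula k) (hφ : φ.QuantifierFree) :
    IsExistentialPred fun _ M ν => ¬ φ.Sat M ν :=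
  (of_atomicType {τ | ¬ φ.HoldsAt τ}).congr fun _ M ν => (not_congr (φ.sat_iff_holdsAt M hφ ν)).symm

theorem sat {k : ℕ} (φ : Formula k) (hφ : φ.IsExistential) :
    IsExistentialPred fun _ M ν => φ.Sat M ν := by
  induction φ with
  | eq x y => exact sat_of_quantifierFree (.eq x y) trivial
  | pos x => exact sat_of_quantifierFree (.pos x) trivial
  | sub x y => exact sat_of_quantifierFree (.sub x y) trivial
  | not φ => exact not_sat_of_quantifierFree φ hφ
  | or φ ψ ih₁ ih₂ => exact (ih₁ hφ.1).or (ih₂ hφ.2)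
  | and φ ψ ih₁ ih₂ => exact (ih₁ hφ.1).and (ih₂ hφ.2)
  | ex φ ih => exact (ih hφ).ex
  | all φ => exact hφ.elim

theorem not_sat {k : ℕ} (φ : Formula k) (hφ : φ.IsUniversal) :
    IsExistentialPred fun _ M ν => ¬ φ.Sat M ν := by
  induction φ with
  | eq x y => exact not_sat_of_quantifierFree (.eq x y) trivial
  | pos x => exact not_sat_of_quantifierFree (.pos x) trivial
  | sub x y => exact not_sat_of_quantifierFree (.sub x y) trivial
  | not φ => exact (sat_of_quantifierFree φ hφ).congr fun _ _ _ => not_not.symm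
  | or φ ψ ih₁ ih₂ => exact ((ih₁ hφ.1).and (ih₂ hφ.2)).congr fun _ _ _ => not_or.symm
  | and φ ψ ih₁ ih₂ => exact ((ih₁ hφ.1).or (ih₂ hφ.2)).congr fun _ _ _ => not_and_or.symm
  | ex φ => exact hφ.elim
  | all φ ih => exact (ih hφ).ex.congr fun _ _ _ => not_forall.symm

end IsExistentialPred

/-! ### Columns of assignments -/

/-- The values of the variables in `V` at a fixed feature. -/
abbrev Column (V : Type) : Type := V → Option Bool

section Columns

variable {V : Type} (H : Set (Column V))

/-- The relation of subsumption in an assignment whose columns are those in `H`. -/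
def SubsumedIn (x y : V) : Prop :=
  ∀ h ∈ H, h x ≠ none → h x = h y

/-- The variable `x` stands for an instance in an assignment whose columns are those in `H`. -/
def IsFull (x : V) : Prop :=
  ∀ h ∈ H, h x ≠ none

variable {H}

theorem SubsumedIn.trans {x y z : V} (h₁ : SubsumedIn H x y) (h₂ : SubsumedIn H y z) :
    SubsumedIn H x z := fun h hh hx =>
  (h₁ h hh hx).trans (h₂ h hh fun hy => hx ((h₁ h hh hx).trans hy))

theorem IsFull.of_subsumedIn {x y : V} (hx : IsFull H x) (hxy : SubsumedIn H x y) : IsFull H y :=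
  fun h hh hy => hx h hh ((hxy h hh (hx h hh)).trans hy)

theorem IsFull.symm {x y : V} (hx : IsFull H x) (hxy : SubsumedIn H x y) : SubsumedIn H y x :=
  fun h hh _ => (hxy h hh (hx h hh)).symm

/-- A choice of one variable from each class of variables that subsume each other. -/
theorem exists_representative (H : Set (Column V)) : ∃ r : V → V,
    (∀ x, SubsumedIn H x (r x) ∧ SubsumedIn H (r x) x) ∧
      ∀ x y, SubsumedIn H x y → SubsumedIn H y x → r x = r y := by
  let s : Setoid V :=
    { r := fun x y => SubsumedIn H x y ∧ SubsumedIn H y x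
      iseqv := ⟨fun _ => ⟨fun _ _ _ => rfl, fun _ _ _ => rfl⟩, fun h => ⟨h.2, h.1⟩,
        fun h h' => ⟨h.1.trans h'.1, h'.2.trans h.2⟩⟩ }
  refine ⟨fun x => (Quotient.mk s x).out, fun x => ?_, fun x y hxy hyx => ?_⟩
  · have h : s.r (Quotient.mk s x).out x := Quotient.exact (Quotient.out_eq _)
    exact ⟨h.2, h.1⟩
  · exact congrArg Quotient.out (Quotient.sound (s := s) ⟨hxy, hyx⟩)

end Columns

section Witness

variable {n k : ℕ} {J : Type} (c : Fin k → PartialInstance n) (H : Set (Column (Fin k ⊕ J)))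

/-- The column `h` may occur at feature `i`: it has the values of the given partial instances. -/
def Agrees (h : Column (Fin k ⊕ J)) (i : Fin n) : Prop :=
  ∀ z, c z i = h (Sum.inl z)

/-- The variable `x` may have value `b` at feature `i`, if the columns come from `H` and each column
`h` in `H` has to occur at feature `g h`. -/
def Allowed (g : H → Fin n) (x : Fin k ⊕ J) (i : Fin n) (b : Bool) : Prop :=
  ∃ h : H, h.1 x = some b ∧ Agrees c h.1 i ∧ ∀ h', g h' = i → h' = h

/-- The set `H` of columns and the set `p` of variables, which are to stand for the positive
instances, do not contradict each other. -/
def Coherent (p : Fin k ⊕ J → Bool) : Prop :=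
  (∀ x, p x = true → IsFull H x) ∧ ∀ x y, IsFull H x → SubsumedIn H x y → p x = p y

/-- Choosing a feature `g h` for each column `h` in `H` is consistent with the given partial
instances, and leaves a path to a leaf with the label `p x` for each variable `x` that stands for an
instance. These paths are chosen separately, so that their existence is easy to decide. -/
structure IsWitness (M : BDD n) (p : Fin k ⊕ J → Bool) (g : H → Fin n) : Prop where
  injective : Injective g
  agrees : ∀ h : H, Agrees c h.1 (g h)
  cover : ∀ i, ∃ h : H, Agrees c h.1 i
  reaches : ∀ x, IsFull H x → M.Reaches (Allowed c H g x) (p x) M.root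

variable {c H}

/-- From a witness one can read off an assignment. A variable that stands for an instance gets an
instance that realizes its path; the other variables get the values of `H` at the features `g h`,
and are as undefined as possible at all other features. -/
theorem IsWitness.exists_assignment {M : BDD n} (hM : M.IsFree) {p : Fin k ⊕ J → Bool}
    {g : H → Fin n} (hg : IsWitness c H M p g) (hp : Coherent H p) :
    ∃ ν : J → PartialInstance n,
      atomicType M.eval (Sum.elim c ν) = (SubsumedIn H, fun x => p x = true) := by
  classical
  obtain ⟨r, hr, hr'⟩ := exists_representative H
  have hbase : ∀ i, ∃ h : H, Agrees c h.1 i ∧ ∀ h', g h' = i → h' = h := by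
    intro i
    by_cases hi : ∃ h, g h = i
    · obtain ⟨h, rfl⟩ := hi
      exact ⟨h, hg.agrees h, fun h' hh => hg.injective hh⟩
    · obtain ⟨h, hh⟩ := hg.cover i
      exact ⟨h, hh, fun h' hh' => (hi ⟨h', hh'⟩).elim⟩
  choose base hbase hbase' using hbase
  have hinst : ∀ x, ∃ e : Instance n, IsFull H x → (∀ i, Allowed c H g x i (e i)) ∧
      M.eval e = p x := by
    intro x
    by_cases hx : IsFull H x
    · have hallowed : ∀ i, ∃ b, Allowed c H g x i b := fun i =>
        let ⟨b, hb⟩ := Option.ne_none_iff_exists'.mp (hx _ (base i).2)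
        ⟨b, base i, hb, hbase i, hbase' i⟩
      obtain ⟨e, he, he'⟩ := BDD.exists_eval_of_reaches hM hallowed (hg.reaches x hx)
      exact ⟨e, fun _ => ⟨he, he'⟩⟩
    · exact ⟨fun _ => false, fun h => (hx h).elim⟩
  choose e he using hinst
  let ν : Fin k ⊕ J → PartialInstance n := fun x i =>
    if IsFull H x then some (e (r x) i)
    else if ∃ h, g h = i then (base i).1 x
    else if hz : ∃ z, SubsumedIn H (Sum.inl z) x ∧ c z i ≠ none then c hz.choose i
    else none
  have hrFull : ∀ {x}, IsFull H x → IsFull H (r x) := fun {x} hx => hx.of_subsumedIn (hr x).1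
  -- a column of `H` that agrees with the given partial instances and gives `x` its value
  have hfull : ∀ x i, IsFull H x → ∃ h : H, h.1 x = ν x i ∧ Agrees c h.1 i ∧
      ∀ h', g h' = i → h' = h := by
    intro x i hx
    obtain ⟨h, hb, ha, hu⟩ := (he (r x) (hrFull hx)).1 i
    refine ⟨h, ?_, ha, hu⟩
    simp only [ν, if_pos hx]
    rw [← hb]
    exact (hr x).1 h h.2 (hx h h.2)
  have hat : ∀ x (h : H), ν x (g h) = h.1 x := by
    intro x h
    by_cases hx : IsFull H x
    · obtain ⟨h', hh', _, hu⟩ := hfull x (g h) hx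
      rw [← hh', hu h rfl]
    · have : ∃ h', g h' = g h := ⟨h, rfl⟩
      simp only [ν, if_neg hx, if_pos this]
      exact congrArg (fun h' : H => h'.1 x) (hbase' (g h) h rfl).symm
  have hoff : ∀ x i, ¬ IsFull H x → (¬ ∃ h, g h = i) → ∀ z, SubsumedIn H (Sum.inl z) x →
      c z i ≠ none → ν x i = c z i := by
    intro x i hx hi z hz hzi
    have hex : ∃ z, SubsumedIn H (Sum.inl z) x ∧ c z i ≠ none := ⟨z, hz, hzi⟩
    simp only [ν, if_neg hx, if_neg hi, dif_pos hex]
    have h₁ := hex.choose_spec.1 _ (base i).2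
    have h₂ := hz _ (base i).2
    rw [← hbase i] at h₁ h₂
    rw [h₁ hex.choose_spec.2, h₂ hzi]
  have hoff' : ∀ x i, ¬ IsFull H x → (¬ ∃ h, g h = i) → ν x i ≠ none →
      ∃ z, SubsumedIn H (Sum.inl z) x ∧ c z i ≠ none ∧ ν x i = c z i := by
    intro x i hx hi hxi
    by_cases hex : ∃ z, SubsumedIn H (Sum.inl z) x ∧ c z i ≠ none
    · obtain ⟨z, hz, hzi⟩ := hex
      exact ⟨z, hz, hzi, hoff x i hx hi z hz hzi⟩
    · simp only [ν, if_neg hx, if_neg hi, dif_neg hex] at hxi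
      exact (hxi rfl).elim
  have hconst : ∀ z, ν (Sum.inl z) = c z := by
    intro z
    funext i
    by_cases hx : IsFull H (Sum.inl z)
    · obtain ⟨h, hh, ha, _⟩ := hfull _ i hx
      rw [← hh, ha]
    by_cases hi : ∃ h, g h = i
    · obtain ⟨h, rfl⟩ := hi
      rw [hat, hg.agrees h]
    by_cases hz : c z i = none
    · by_contra hne
      obtain ⟨z', hz', hz'i, hzz⟩ := hoff' _ i hx hi (fun h' => hne (h'.trans hz.symm))
      have h := hz' _ (base i).2
      rw [← hbase i, ← hbase i] at h
      exact hz'i ((h hz'i).trans hz)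
    · exact hoff _ i hx hi z (fun _ _ _ => rfl) hz
  have hsub : ∀ x y, SubsumedIn H x y → Subsumed (ν x) (ν y) := by
    intro x y hxy i hxi
    by_cases hx : IsFull H x
    · have hy := hx.of_subsumedIn hxy
      simp only [ν, if_pos hx, if_pos hy, hr' x y hxy (hx.symm hxy)]
    by_cases hi : ∃ h, g h = i
    · obtain ⟨h, rfl⟩ := hi
      rw [hat] at hxi ⊢
      rw [hat]
      exact hxy h h.2 hxi
    obtain ⟨z, hz, hzi, hxz⟩ := hoff' x i hx hi hxi
    rw [hxz]
    by_cases hy : IsFull H y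
    · obtain ⟨h, hh, ha, _⟩ := hfull y i hy
      rw [← hh, ha]
      rw [ha] at hzi
      exact hz.trans hxy h h.2 hzi
    · exact (hoff y i hy hi z (hz.trans hxy) hzi).symm
  refine ⟨ν ∘ Sum.inr, ?_⟩
  have hν : Sum.elim c (ν ∘ Sum.inr) = ν := by
    funext x
    rcases x with z | x
    · exact (hconst z).symm
    · rfl
  rw [hν]
  refine Prod.ext ?_ ?_
  · funext x y
    refine propext ⟨fun h h' hh' hne => ?_, hsub x y⟩
    have := h (g ⟨h', hh'⟩)
    rw [hat, hat] at this
    exact this hne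
  · funext x
    refine propext ⟨?_, fun hx => ?_⟩
    · rintro ⟨e', he', hpos⟩
      have hx : IsFull H x := fun h hh hne => by
        have := he' (g ⟨h, hh⟩)
        rw [hat] at this
        exact absurd (this.symm.trans hne) (by simp)
      have hee : e' = e (r x) := by
        funext i
        have := he' i
        simp only [ν, if_pos hx, Option.some.injEq] at this
        exact this.symm
      change p x = true
      rw [hp.2 x (r x) hx (hr x).1, ← (he (r x) (hrFull hx)).2, ← hee, hpos]
    · have hx' := hp.1 x hx
      refine ⟨e (r x), fun i => by simp only [ν, if_pos hx'], ?_⟩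
      rw [(he (r x) (hrFull hx')).2, ← hp.2 x (r x) hx' (hr x).1, hx]

/-- The columns of an assignment, each with a feature at which it occurs, form a witness. -/
theorem exists_witness (M : BDD n) (c : Fin k → PartialInstance n) (ν : J → PartialInstance n) :
    ∃ H p, atomicType M.eval (Sum.elim c ν) = (SubsumedIn H, fun x => p x = true) ∧
      Coherent H p ∧ ∃ g, IsWitness c H M p g := by
  classical
  set μ := Sum.elim c ν with hμ
  let col : Fin n → Column (Fin k ⊕ J) := fun i x => μ x i
  have hsub : ∀ x y, SubsumedIn (Set.range col) x y ↔ Subsumed (μ x) (μ y) := fun x y =>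
    Set.forall_mem_range
  have hfull : ∀ x, IsFull (Set.range col) x → ∃ e : Instance n, ∀ i, μ x i = some (e i) := by
    intro x hx
    have : ∀ i, ∃ b, μ x i = some b := fun i =>
      Option.ne_none_iff_exists'.mp (hx _ (Set.mem_range_self i))
    choose e he using this
    exact ⟨e, he⟩
  have hag : ∀ i, Agrees c (col i) i := fun i z => rfl
  choose g hg using fun h : Set.range col => h.2
  refine ⟨Set.range col, fun x => decide (IsPos M.eval (μ x)), ?_, ⟨fun x hx => ?_,
    fun x y hx hxy => ?_⟩, g, ⟨fun h h' hh => ?_, fun h => ?_, fun i => ?_, fun x hx => ?_⟩⟩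
  · refine Prod.ext ?_ ?_
    · funext x y
      exact propext (hsub x y).symm
    · simp [atomicType]
  · obtain ⟨e, he, _⟩ := of_decide_eq_true hx
    rintro _ ⟨i, rfl⟩ hne
    exact absurd ((he i).symm.trans hne) (by simp)
  · have h : μ x = μ y := subsumed_antisymm.mpr
      ⟨(hsub x y).mp hxy, (hsub y x).mp (hx.symm hxy)⟩
    simp only [h]
  · exact Subtype.ext ((hg h).symm.trans ((congrArg col hh).trans (hg h')))
  · have := hag (g h)
    rwa [hg] at this
  · exact ⟨⟨col i, Set.mem_range_self i⟩, hag i⟩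
  · obtain ⟨e, he⟩ := hfull x hx
    have hpos : decide (IsPos M.eval (μ x)) = M.eval e := by
      refine Bool.eq_iff_iff.mpr (decide_eq_true_iff.trans ⟨?_, fun h => ⟨e, he, h⟩⟩)
      rintro ⟨e', he', h⟩
      have : e = e' := funext fun i => Option.some.inj ((he i).symm.trans (he' i))
      rwa [this]
    rw [hpos]
    refine M.reaches_of_eval fun i => ⟨⟨col i, Set.mem_range_self i⟩, he i, hag i, ?_⟩
    rintro h' rfl
    exact Subtype.ext (hg h').symm

end Witness

/-! ### Deciding the existence of a witness -/

/-- The nodes from which a leaf can be reached are found within as many rounds as there are nodes,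
since the number of nodes below a node decreases along edges. -/
theorem BDD.reaches_iff_rounds {n N : ℕ} {M : BDD n} {P : Fin n → Bool → Prop} {b : Bool}
    {Q : (ℕ → Prop) → ℕ → Prop} (hN : M.size < N)
    (hQ : ∀ R (u : Fin M.size), Q R u ↔ M.node u = .leaf b ∨ ∃ v, M.StepIn P u v ∧ R v)
    (u : Fin M.size) : M.Reaches P b u ↔ ∃ t < N, rounds Q N t u := by
  constructor
  · rintro ⟨v, hv, hb⟩
    suffices h : ∀ t, M.rank u < t → rounds Q N t u from
      ⟨M.rank u + 1, Nat.lt_of_le_of_lt (M.rank_lt_size u) hN, h _ (Nat.lt_succ_self _)⟩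
    induction hv using Relation.ReflTransGen.head_induction_on with
    | refl =>
      rintro (_ | t) ht
      · omega
      · exact ⟨v.2.trans hN, (hQ _ _).mpr (Or.inl hb)⟩
    | @head u w hu _ ih =>
      have hrank : M.rank w < M.rank u := by
        obtain ⟨i, next, c, h, _, hw⟩ := hu
        exact M.rank_lt_rank ⟨c, i, next, h, hw⟩
      rintro (_ | t) ht
      · omega
      · exact ⟨u.2.trans hN, (hQ _ _).mpr (Or.inr ⟨w, hu, ih t (by omega)⟩)⟩
  · rintro ⟨t, -, ht⟩
    induction t generalizing u with
    | zero => exact ht.elim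
    | succ t ih =>
      rcases (hQ _ _).mp ht.2 with h | ⟨v, hv, h⟩
      · exact ⟨u, .refl, h⟩
      · obtain ⟨w, hw, hb⟩ := ih v h
        exact ⟨w, .head hv hw, hb⟩

section Bounds

variable {C : BDDClass} {k : ℕ} (a : EvalInput C k)

theorem dim_lt_length : a.dim < (encodeInput a).length := by
  simp [encodeInput, encodeNum]

theorem size_lt_length : a.model.size < (encodeInput a).length := by
  have h := (countP_flatMap_encodeNode a.model.node (List.finRange a.model.size)).symm.trans_le
    List.countP_le_length
  rw [List.length_finRange] at h
  simp only [encodeInput, List.length_append, List.length_singleton]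
  omega

end Bounds

namespace Definable

variable {C : BDDClass} {k d : ℕ}

theorem ltDim (x : Fin d) : OnInputs fun (a : EvalInput C k) ρ => (ρ x).length < a.dim := by
  refine congr (P := fun a ρ => ∃ n < (encodeInput a).length, n = a.dim ∧ (ρ x).length < n) ?_ ?_
  · apply ex
    exact and (dim (Fin.last d)) (lt x.castSucc (Fin.last d))
  · intro a ρ
    exact ⟨fun ⟨_, _, h, hx⟩ => h ▸ hx, fun hx => ⟨_, dim_lt_length a, rfl, hx⟩⟩

variable {J : Type}

theorem agrees (h : Column (Fin k ⊕ J)) (x : Fin d) :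
    OnInputs fun (a : EvalInput C k) ρ => ∃ i, i.val = (ρ x).length ∧ Agrees a.inst h i := by
  refine congr (and (ltDim x) (allFinite fun z => component z (h (Sum.inl z)) x)) fun a ρ => ?_
  constructor
  · rintro ⟨hx, h'⟩
    refine ⟨⟨_, hx⟩, rfl, fun z => ?_⟩
    obtain ⟨i, hi, hz⟩ := h' z
    obtain rfl : i = ⟨_, hx⟩ := Fin.ext hi
    exact hz
  · rintro ⟨i, hi, h'⟩
    exact ⟨hi ▸ i.2, fun z => ⟨i, hi, h' z⟩⟩

variable [Finite J] (H : Set (Column (Fin k ⊕ J)))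

theorem reaches (y : H → Fin d) (x : Fin k ⊕ J) (c : Bool) :
    OnInputs fun (a : EvalInput C k) ρ => ∃ g : H → Fin a.dim,
      (∀ h, (g h).val = (ρ (y h)).length) ∧
        a.model.Reaches (Allowed a.inst H g x) c a.model.root := by
  let Q (a : EvalInput C k) (ρ : Lists d) (R : ℕ → Prop) (u : ℕ) : Prop :=
    (∃ v, v.val = u ∧ a.model.node v = .leaf c) ∨
      ∃ i < (encodeInput a).length, ∃ w < (encodeInput a).length, R w ∧ ∃ b,
        (∃ v f next, a.model.node v = .branch f next ∧ v.val = u ∧ f.val = i ∧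
          (next b).val = w) ∧
        ∃ h : H, h.1 x = some b ∧ (∃ f, f.val = i ∧ Agrees a.inst h.1 f) ∧
          ∀ h', (ρ (y h')).length = i → h' = h
  refine congr (P := fun a ρ => (∀ h, (ρ (y h)).length < a.dim) ∧
    ∃ r < (encodeInput a).length, r = a.model.root ∧ ∃ t < (encodeInput a).length,
      rounds (Q a ρ) (encodeInput a).length t r) ?_ ?_
  · refine and (allFinite fun h => ltDim (y h)) ?_
    apply ex
    refine and (root (Fin.last d)) ?_
    apply ex
    refine iter (Fin.last (d + 1)) (Fin.last d).castSucc
      (Q := fun a ρ => Q a fun x => ρ x.castSucc.castSucc) ?_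
    refine or (leaf c (Fin.last (d + 3))) ?_
    apply ex
    apply ex
    refine and (mem (Fin.last (d + 5)) (Fin.last (d + 2)).castSucc.castSucc.castSucc)
      (exFinite fun b => and (edge b (Fin.last (d + 3)).castSucc.castSucc
        (Fin.last (d + 4)).castSucc (Fin.last (d + 5))) (exFinite fun h => ?_))
    exact and (const _) (and (agrees h.1 (Fin.last (d + 4)).castSucc) (allFinite fun h' =>
      imp (eq (y h').castSucc.castSucc.castSucc.castSucc.castSucc.castSucc
        (Fin.last (d + 4)).castSucc) (const _)))
  · intro a ρ
    have hsize := size_lt_length a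
    have hdim := dim_lt_length a
    have key : ∀ g : H → Fin a.dim, (∀ h, (g h).val = (ρ (y h)).length) →
        (a.model.Reaches (Allowed a.inst H g x) c a.model.root ↔
          ∃ t < (encodeInput a).length, rounds (Q a ρ) (encodeInput a).length t a.model.root) := by
      intro g hg
      refine BDD.reaches_iff_rounds hsize (fun R u => or_congr ?_ ?_) _
      · constructor
        · rintro ⟨v, hv, h⟩
          obtain rfl := Fin.ext hv
          exact h
        · exact fun h => ⟨u, rfl, h⟩
      · constructor
        · rintro ⟨_, _, _, _, hR, b, ⟨v, f, next, hv, hu, rfl, rfl⟩, h, hb, ⟨f', hf, ha⟩, h'⟩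
          obtain rfl := Fin.ext hu
          obtain rfl := Fin.ext hf
          exact ⟨next b, ⟨f', next, b, hv, ⟨h, hb, ha, fun h'' e =>
            h' h'' ((hg h'').symm.trans (congrArg Fin.val e))⟩, rfl⟩, hR⟩
        · rintro ⟨_, ⟨i, next, b, hu, ⟨h, hb, ha, h'⟩, rfl⟩, hR⟩
          exact ⟨i, i.2.trans hdim, next b, (next b).2.trans hsize, hR, b,
            ⟨u, i, next, hu, rfl, rfl, rfl⟩, h, hb, ⟨i, rfl, ha⟩,
            fun h'' e => h' h'' (Fin.ext ((hg h'').trans e))⟩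
    constructor
    · rintro ⟨hy, _, _, rfl, h⟩
      exact ⟨fun h => ⟨_, hy h⟩, fun _ => rfl, (key _ fun _ => rfl).mpr h⟩
    · rintro ⟨g, hg, h⟩
      exact ⟨fun h => hg h ▸ (g h).2, _, a.model.root.2.trans hsize, rfl, (key g hg).mp h⟩

theorem isWitness (p : Fin k ⊕ J → Bool) (y : H → Fin d) :
    OnInputs fun (a : EvalInput C k) ρ => ∃ g : H → Fin a.dim,
      (∀ h, (g h).val = (ρ (y h)).length) ∧ IsWitness a.inst H a.model p g := by
  refine congr (P := fun a ρ =>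
    (∀ h : H, ∃ i, i.val = (ρ (y h)).length ∧ Agrees a.inst h.1 i) ∧
    (∀ h h', (ρ (y h)).length = (ρ (y h')).length → h = h') ∧
    (∀ m < (encodeInput a).length, m < a.dim →
      ∃ h : H, ∃ i, i.val = m ∧ Agrees a.inst h.1 i) ∧
    ∀ x, IsFull H x → ∃ g : H → Fin a.dim, (∀ h, (g h).val = (ρ (y h)).length) ∧
      a.model.Reaches (Allowed a.inst H g x) (p x) a.model.root) ?_ ?_
  · refine and (allFinite fun h => agrees h.1 (y h)) (and (allFinite fun h => allFinite fun h' =>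
      imp (eq (y h) (y h')) (const _)) (and ?_ (allFinite fun x =>
        imp (const _) (reaches H y x (p x)))))
    apply all
    exact imp (ltDim (Fin.last d)) (exFinite fun h => agrees h.1 (Fin.last d))
  · intro a ρ
    constructor
    · rintro ⟨h₁, h₂, h₃, h₄⟩
      choose g hg hg' using h₁
      refine ⟨g, hg, fun h h' e => h₂ h h' ?_, hg', fun i => ?_, fun x hx => ?_⟩
      · rw [← hg, ← hg, e]
      · obtain ⟨h, i', hi, ha⟩ := h₃ i (i.2.trans (dim_lt_length a)) i.2
        obtain rfl := Fin.ext hi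
        exact ⟨h, ha⟩
      · obtain ⟨g', hg', h⟩ := h₄ x hx
        obtain rfl : g' = g := funext fun h => Fin.ext ((hg' h).trans (hg h).symm)
        exact h
    · rintro ⟨g, hg, hw⟩
      refine ⟨fun h => ⟨g h, hg h, hw.agrees h⟩, fun h h' e => hw.injective (Fin.ext ?_),
        fun m _ hm => ?_, fun x hx => ⟨g, hg, hw.reaches x hx⟩⟩
      · rw [hg, hg, e]
      · obtain ⟨h, ha⟩ := hw.cover ⟨m, hm⟩
        exact ⟨h, ⟨m, hm⟩, rfl, ha⟩

theorem existsWitness (p : Fin k ⊕ J → Bool) :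
    OnInputs fun (a : EvalInput C k) (_ : Lists d) => ∃ g, IsWitness a.inst H a.model p g := by
  obtain ⟨m, ⟨e⟩⟩ := Finite.exists_equiv_fin H
  refine congr (P := fun a ρ => ∃ g' : Fin m → ℕ, (∀ j, g' j < (encodeInput a).length) ∧
    ∃ g : H → Fin a.dim, (∀ h, (g h).val = g' (e h)) ∧ IsWitness a.inst H a.model p g) ?_ ?_
  · apply exTuple
    exact isWitness H p fun h => (e h).natAdd d
  · intro a ρ
    constructor
    · rintro ⟨_, _, g, _, h⟩
      exact ⟨g, h⟩
    · rintro ⟨g, h⟩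
      exact ⟨fun j => g (e.symm j), fun j => (g _).2.trans (dim_lt_length a), g,
        fun h => by simp, h⟩

/-- In classes of free diagrams, existential predicates are definable: a set of columns and a set
of positive variables determine the atomic type of an assignment, and there are only finitely many
of them. -/
theorem existentialPred (hC : ∀ n M, C n M → M.IsFree)
    {P : ∀ n : ℕ, (Instance n → Bool) → (Fin k → PartialInstance n) → Prop}
    (hP : IsExistentialPred P) :
    OnInputs fun (a : EvalInput C k) (_ : Lists d) => P a.dim a.model.eval a.inst := by
  obtain ⟨J, _, T, hT⟩ := hP
  refine congr (P := fun a _ => ∃ (H : Set (Column (Fin k ⊕ J))) (p : Fin k ⊕ J → Bool),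
    ((SubsumedIn H, fun x => p x = true) ∈ T ∧ Coherent H p) ∧
      ∃ g, IsWitness a.inst H a.model p g) ?_ ?_
  · exact exFinite fun H => exFinite fun p => and (const _) (existsWitness H p)
  · intro a _
    rw [hT]
    constructor
    · rintro ⟨H, p, ⟨hmem, hp⟩, g, hg⟩
      obtain ⟨ν, hν⟩ := hg.exists_assignment (hC _ _ a.mem) hp
      exact ⟨ν, hν ▸ hmem⟩
    · rintro ⟨ν, hν⟩
      obtain ⟨H, p, h, hp, hg⟩ := exists_witness a.model a.inst ν
      exact ⟨H, p, ⟨h ▸ hν, hp⟩, hg⟩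

end Definable

/-- The negation of a universal formula is existential, so that in both cases satisfaction is
definable over the codes of inputs. -/
theorem evalInPolyTime {k : ℕ} (φ : Formula k) (hφ : φ.IsExistential ∨ φ.IsUniversal)
    {C : BDDClass} (hC : ∀ n M, C n M → M.IsFree) : EvalInPolyTime φ C := by
  have h : Definable.OnInputs fun (a : EvalInput C k) (_ : Lists 0) =>
      φ.Sat a.model.eval a.inst := by
    rcases hφ with hφ | hφ
    · exact Definable.existentialPred hC (.sat φ hφ)
    · exact (Definable.existentialPred hC (.not_sat φ hφ)).not.congr fun _ _ => not_not
  obtain ⟨e, he⟩ := h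
  refine e.computable encodeInput (evalAnswer φ C) fun a => ?_
  rw [Bool.eq_iff_iff, he, evalAnswer]
  exact (@decide_eq_true_iff _ (_)).symm

theorem BDD.IsOrdered.isFree {n : ℕ} {M : BDD n} (hM : M.IsOrdered) : M.IsFree := by
  obtain ⟨r, hr⟩ := hM
  exact fun u v i huv hu hv => @lt_irrefl _ r.toPreorder i (hr u v i i huv hu hv)

end FOIL

theorem proposition2 {k : ℕ} (φ : FOIL.Formula k) (hφ : φ.IsExistential ∨ φ.IsUniversal) :
    FOIL.EvalInPolyTime φ FOIL.DT ∧ FOIL.EvalInPolyTime φ FOIL.OBDD ∧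
      FOIL.EvalInPolyTime φ FOIL.FBDD :=
  ⟨FOIL.evalInPolyTime φ hφ fun _ _ h => h.1, FOIL.evalInPolyTime φ hφ fun _ _ h => h.isFree,
    FOIL.evalInPolyTime φ hφ fun _ _ h => h⟩
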